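/- Let $n\ge 1$. Let $\mathscr M_+(\mathbb R^n)$ be the space of positive locally finite Borel measures on $\mathbb R^n$, with the $\sigma$-algebra generated by the evaluations $p\mapsto p(B)$, $B$ Borel. A random measure on $\mathbb R^n$ is a probability measure $\mu$ on $\mathscr M_+(\mathbb R^n)$; it is invariant if it is preserved by all translations of $\mathbb R^n$, and locally square-integrable if $\int p(B)^2\,d\mu(p)<\infty$ for every bounded Borel set $B$. For such an invariant, locally square-integrable $\mu$, let $\iota_\mu$ be its intensity, i.e. $\int p(B)\,d\mu(p)=\iota_\mu\,\mathrm{Vol}(B)$ for bounded Borel $B$, and let $$\mathrm{NV}_\mu(r)=\mathrm{Var}_\mu\big(p\mapsto p(B_r)\big),\qquad B_r=\{x\in\mathbb R^n:\|x\|<r\},$$ be its number variance. Its autocorrelation measure $\eta_\mu$ is given by $$\eta_\mu(\varphi)=\int_{\mathscr M_+(\mathbb R^n)}\Big(\int_{\mathbb R^n}\int_{\mathbb R^n}\varphi(y-x)\,b(x)\,dp(x)\,dp(y)\Big)d\mu(p)-\iota_\mu^2\int_{\mathbb R^n}\varphi(x)\,dx ,$$ where $b\ge 0$ is any bounded measurable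 function with bounded support and $\int b(x)\,dx=1$ (the choice of $b$ is immaterial). Its diffraction measure $\hat\eta_\mu$ is the unique positive tempered Radon measure on $\mathbb R^n$ with $\eta_\mu(f)=\int\hat f(\xi)\,d\hat\eta_\mu(\xi)$ for all Schwartz functions $f$, where $\hat f(\xi)=\int f(x)e^{-i\langle x,\xi\rangle}\,dx$. The random measure $\mu$ is stealthy if $\hat\eta_\mu(B_{\lambda_o})=0$ for some $\lambda_o>0$. **Corollary.** Let $\mu$ be a stealthy (invariant, locally square-integrable) random measure on $\mathbb R^n$. Then $$\lim_{R\to+\infty}\frac1R\int_0^R\frac{\mathrm{NV}_\mu(r)}{r^{n-1}}\,dr=2^n\pi^{n-1}\int_{\mathbb R^n}\frac{d\hat\eta_\mu(\xi)}{\|\xi\|^{n+1}},$$ where the integral on the right and the integrals over $[0,R]$ on the left are finite. -/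

import Mathlib

open MeasureTheory Filter Topology
open scoped SchwartzMap

noncomputable section

namespace Stealthy

/-- The space of positive locally finite Borel measures on `ℝⁿ`. Its `σ`-algebra is the one
inherited from `Measure`, generated by the evaluations `p ↦ p B` on Borel sets; on locally finite
measures this is the smallest one for which `p ↦ ∫ f dp` is measurable for all bounded
measurable `f` with bounded support. -/
abbrev LFMeasure (n : ℕ) : Type :=
  {p : Measure (EuclideanSpace ℝ (Fin n)) // IsLocallyFiniteMeasure p}

theorem isLocallyFiniteMeasure_translate {n : ℕ} (v : EuclideanSpace ℝ (Fin n))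
    (p : Measure (EuclideanSpace ℝ (Fin n))) (hp : IsLocallyFiniteMeasure p) :
    IsLocallyFiniteMeasure (p.map (fun x => v + x)) := by
  refine ⟨fun x => ?_⟩
  obtain ⟨s, hs, hps⟩ := hp.finiteAtNhds (-v + x)
  refine ⟨(Homeomorph.addLeft (-v)) ⁻¹' s, (Homeomorph.addLeft (-v)).continuous.continuousAt hs, ?_⟩
  have h : p.map (fun x => v + x) = p.map (Homeomorph.addLeft v).toMeasurableEquiv := rfl
  rw [h, MeasurableEquiv.map_apply]
  convert hps using 2
  ext y
  simp

/-- The translation action of `ℝⁿ` on locally finite measures by push-forward. -/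
def translate {n : ℕ} (v : EuclideanSpace ℝ (Fin n)) (p : LFMeasure n) : LFMeasure n :=
  ⟨p.1.map (fun x => v + x), isLocallyFiniteMeasure_translate v p.1 p.2⟩

/-- A random measure (the law `μ` on the space of locally finite measures) is invariant if it is
preserved by all translations. -/
def IsInvariant {n : ℕ} (μ : Measure (LFMeasure n)) : Prop :=
  ∀ v : EuclideanSpace ℝ (Fin n), μ.map (translate v) = μ

/-- Local square-integrability: `∫ p(B)² dμ(p) < ∞` for every bounded Borel set `B`. -/
def IsLocallySquareIntegrable {n : ℕ} (μ : Measure (LFMeasure n)) : Prop :=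
  ∀ B : Set (EuclideanSpace ℝ (Fin n)), MeasurableSet B → Bornology.IsBounded B →
    ∫⁻ p, (p.1 B) ^ 2 ∂μ < ⊤

/-- The intensity `ι_μ`, the scalar with `𝔼_μ[p(B)] = ι_μ Vol(B)`, read off on the unit ball. -/
def intensity {n : ℕ} (μ : Measure (LFMeasure n)) : ℝ :=
  (∫ p, p.1.real (Metric.ball 0 1) ∂μ) /
    (volume : Measure (EuclideanSpace ℝ (Fin n))).real (Metric.ball 0 1)

/-- The number variance `NV_μ(r) = Var_μ(p(B_r))`. -/
def numberVariance {n : ℕ} (μ : Measure (LFMeasure n)) (r : ℝ) : ℝ :=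
  ProbabilityTheory.variance (fun p : LFMeasure n => p.1.real (Metric.ball 0 r)) μ

/-- The truncation functions used in the definition of the autocorrelation: nonnegative bounded
measurable functions with bounded support and total Lebesgue integral one. -/
structure IsTruncation {n : ℕ} (b : EuclideanSpace ℝ (Fin n) → ℝ) : Prop where
  measurable : Measurable b
  nonneg : ∀ x, 0 ≤ b x
  bounded : ∃ C : ℝ, ∀ x, b x ≤ C
  support_bounded : Bornology.IsBounded (Function.support b)
  integral_eq_one : ∫ x, b x = 1

/-- The autocorrelation measure of `μ`, as a linear functional on test functions:
`η_μ(φ) = ∫ (∫∫ φ(y - x) b(x) dp(x) dp(y)) dμ(p) - ι_μ² ∫ φ(x) dx`. -/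
def autocorrelation {n : ℕ} (μ : Measure (LFMeasure n)) (b : EuclideanSpace ℝ (Fin n) → ℝ)
    (φ : EuclideanSpace ℝ (Fin n) → ℂ) : ℂ :=
  (∫ p : LFMeasure n, (∫ y, ∫ x, φ (y - x) * (b x : ℂ) ∂p.1 ∂p.1) ∂μ)
    - (intensity μ : ℂ) ^ 2 * ∫ x, φ x

/-- The Fourier transform with the convention `f̂(ξ) = ∫ f(x) e^{-i⟨x, ξ⟩} dx`. -/
def fourierHat {n : ℕ} (f : EuclideanSpace ℝ (Fin n) → ℂ) (ξ : EuclideanSpace ℝ (Fin n)) : ℂ :=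
  ∫ x, f x * Complex.exp (-Complex.I * (inner ℝ x ξ : ℝ))

/-- `ν` is the diffraction measure of `μ`: the (unique) positive tempered Radon measure which is
the Fourier transform of the autocorrelation measure, i.e. `η_μ(f) = ∫ f̂ dν` for all Schwartz
functions `f`. The functional `η_μ` is formed with the truncation function `b`. -/
structure IsDiffractionMeasure {n : ℕ} (μ : Measure (LFMeasure n))
    (b : EuclideanSpace ℝ (Fin n) → ℝ) (ν : Measure (EuclideanSpace ℝ (Fin n))) : Prop where
  locallyFinite : IsLocallyFiniteMeasure ν
  tempered : ν.HasTemperateGrowth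
  fourier_eq : ∀ f : 𝓢(EuclideanSpace ℝ (Fin n), ℂ),
    autocorrelation μ b f = ∫ ξ, fourierHat f ξ ∂ν

/-- The random measure with diffraction measure `ν` is stealthy: `ν` vanishes on a centered ball
of positive radius. -/
def IsStealthy {n : ℕ} (ν : Measure (EuclideanSpace ℝ (Fin n))) : Prop :=
  ∃ lam : ℝ, 0 < lam ∧ ν (Metric.ball 0 lam) = 0

end Stealthy

end

noncomputable section

namespace Stealthy

open Set

/-! Write `n = m + 1` and `a = m / 2`. The proof combines a spectral formula for the number variance
with the mean square of a Bessel function.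

Spectral side. For a test function `φ`, invariance turns the autocorrelation functional at `selfCorr
φ` into the variance of `p ↦ ∫ φ dp`, while the Fourier transform of `selfCorr φ` is `|φ̂|²`. For
smooth `φ` the defining property of `ν` therefore gives an isometry `‖φ̂‖_{L²(ν)} = ‖centered
statistic‖_{L²(μ)}`. Approximating the indicator of a ball by bumps extends it to
`numberVariance_eq`: the variance at radius `r` is the `ν`-integral of `|ballHat r|²`.

Bessel side. Slicing the ball gives `ballHat r ξ = r^(m+1) ω_m F(r‖ξ‖)`, where `ω_m` is the volume
of the unit ball of `ℝ^m` and `F` is the cosine transform of `(1 - x²)^a`. With `v(t) = t^(a+1)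
F(t)` this becomes `|ballHat r ξ|² = r^m ω_m² v(r‖ξ‖)² / ‖ξ‖^(m+2)`, which explains both exponents
in the statement. The function `v` solves `v'' = (a(a+1)/t² - 1) v`, a perturbed harmonic
oscillator, so `(v' + iv) e^{-it}` has a limit `W` and `v²` has mean `|W|²/2`. An Abelian argument
on the Laplace transform gives `|W| = 2^(a+1) Γ(a+1)` (`norm_limit_besselW`). The Gamma factor
cancels against `ω_m`, leaving the constant `2^(m+1) π^m` of `tendsto_mean_waveProfile`.

Conclusion. Stealthiness keeps `‖ξ‖` away from `0` for `ν`-almost every `ξ`. Averaging the variance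
over `1 < r ≤ 2` bounds the spectral integral (`integrable_inv_norm_pow`). Since `v` is bounded,
Fubini and dominated convergence then carry the Cesàro mean in `r` inside the integral over `ξ`
(`tendsto_mean_numberVariance`). -/

/-! ### Bessel functions as cosine transforms of Gegenbauer weights. -/

/-- The cosine transform over `[-1, 1]` of a weight. -/
def cosTransform (g : ℝ → ℝ) (t : ℝ) : ℝ := ∫ x in (-1 : ℝ)..1, g x * Real.cos (t * x)

/-- The sine transform over `[-1, 1]` of a weight. -/
def sinTransform (g : ℝ → ℝ) (t : ℝ) : ℝ := ∫ x in (-1 : ℝ)..1, g x * Real.sin (t * x)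

theorem hasDerivAt_cosTransform {g : ℝ → ℝ} (hg : Continuous g) (t : ℝ) :
    HasDerivAt (cosTransform g) (-sinTransform (fun x => x * g x) t) t := by
  have h := (intervalIntegral.hasDerivAt_integral_of_dominated_loc_of_deriv_le
    (μ := volume) (a := -1) (b := 1) (F := fun t x => g x * Real.cos (t * x))
    (F' := fun t x => -(x * g x * Real.sin (t * x))) (x₀ := t) (s := univ)
    (bound := fun x => |x * g x|) univ_mem
    (.of_forall fun t => (by fun_prop : Continuous fun x => g x * Real.cos (t * x)).aestronglyMeasurable)
    ((by fun_prop : Continuous fun x => g x * Real.cos (t * x)).intervalIntegrable _ _)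
    (by fun_prop : Continuous fun x => -(x * g x * Real.sin (t * x))).aestronglyMeasurable
    (.of_forall fun x _ t _ => ?_)
    ((by fun_prop : Continuous fun x => |x * g x|).intervalIntegrable _ _)
    (.of_forall fun x _ t _ => ?_)).2
  · refine HasDerivAt.congr_deriv h ?_
    rw [intervalIntegral.integral_neg]
    rfl
  · rw [norm_neg, norm_mul, Real.norm_eq_abs, Real.norm_eq_abs]
    exact mul_le_of_le_one_right (abs_nonneg _) (Real.abs_sin_le_one _)
  · have := ((Real.hasDerivAt_cos (t * x)).comp t ((hasDerivAt_id t).mul_const x)).const_mul (g x)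
    refine HasDerivAt.congr_deriv this ?_
    simp; ring

theorem hasDerivAt_sinTransform {g : ℝ → ℝ} (hg : Continuous g) (t : ℝ) :
    HasDerivAt (sinTransform g) (cosTransform (fun x => x * g x) t) t := by
  have h := (intervalIntegral.hasDerivAt_integral_of_dominated_loc_of_deriv_le
    (μ := volume) (a := -1) (b := 1) (F := fun t x => g x * Real.sin (t * x))
    (F' := fun t x => (x * g x * Real.cos (t * x))) (x₀ := t) (s := univ)
    (bound := fun x => |x * g x|) univ_mem
    (.of_forall fun t => (by fun_prop : Continuous fun x => g x * Real.sin (t * x)).aestronglyMeasurable)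
    ((by fun_prop : Continuous fun x => g x * Real.sin (t * x)).intervalIntegrable _ _)
    (by fun_prop : Continuous fun x => (x * g x * Real.cos (t * x))).aestronglyMeasurable
    (.of_forall fun x _ t _ => ?_)
    ((by fun_prop : Continuous fun x => |x * g x|).intervalIntegrable _ _)
    (.of_forall fun x _ t _ => ?_)).2
  · exact h
  · rw [norm_mul, Real.norm_eq_abs, Real.norm_eq_abs]
    exact mul_le_of_le_one_right (abs_nonneg _) (Real.abs_cos_le_one _)
  · have := ((Real.hasDerivAt_sin (t * x)).comp t ((hasDerivAt_id t).mul_const x)).const_mul (g x)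
    refine HasDerivAt.congr_deriv this ?_
    simp; ring

theorem continuous_cosTransform {g : ℝ → ℝ} (hg : Continuous g) : Continuous (cosTransform g) :=
  continuous_iff_continuousAt.2 fun t => (hasDerivAt_cosTransform hg t).continuousAt

theorem continuous_sinTransform {g : ℝ → ℝ} (hg : Continuous g) : Continuous (sinTransform g) :=
  continuous_iff_continuousAt.2 fun t => (hasDerivAt_sinTransform hg t).continuousAt

/-- The Gegenbauer weight `(1 - x²)^a`. -/
def gegenbauer (a x : ℝ) : ℝ := (1 - x ^ 2) ^ a

theorem continuous_gegenbauer {a : ℝ} (ha : 0 ≤ a) : Continuous (gegenbauer a) :=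
  Continuous.rpow_const (by fun_prop) fun _ => Or.inr ha

theorem gegenbauer_nonneg {a x : ℝ} (hx : x ∈ Icc (-1 : ℝ) 1) : 0 ≤ gegenbauer a x :=
  Real.rpow_nonneg (by nlinarith [hx.1, hx.2]) _

theorem gegenbauer_le_one {a x : ℝ} (ha : 0 ≤ a) (hx : x ∈ Icc (-1 : ℝ) 1) :
    gegenbauer a x ≤ 1 :=
  Real.rpow_le_one (by nlinarith [hx.1, hx.2]) (by nlinarith [hx.1, hx.2]) ha

/-- Up to a power of `t` and a constant, the Bessel function of order `a + 1 / 2`. -/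
def besselF (a : ℝ) : ℝ → ℝ := cosTransform (gegenbauer a)

/-- The derivative of `besselF`. -/
def besselF' (a t : ℝ) : ℝ := -sinTransform (fun x => x * gegenbauer a x) t

theorem hasDerivAt_besselF {a : ℝ} (ha : 0 ≤ a) (t : ℝ) :
    HasDerivAt (besselF a) (besselF' a t) t :=
  hasDerivAt_cosTransform (continuous_gegenbauer ha) t

theorem continuous_besselF {a : ℝ} (ha : 0 ≤ a) : Continuous (besselF a) :=
  continuous_cosTransform (continuous_gegenbauer ha)

theorem continuous_besselF' {a : ℝ} (ha : 0 ≤ a) : Continuous (besselF' a) :=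
  (continuous_sinTransform (continuous_id.mul (continuous_gegenbauer ha))).neg

theorem abs_besselF_le {a : ℝ} (ha : 0 ≤ a) (t : ℝ) : |besselF a t| ≤ 2 := by
  have := intervalIntegral.norm_integral_le_of_norm_le_const (a := -1) (b := 1) (C := 1)
    (f := fun x => gegenbauer a x * Real.cos (t * x)) (fun x hx => ?_)
  · rw [Real.norm_eq_abs] at this
    refine this.trans ?_
    norm_num
  · rw [uIoc_of_le (by norm_num)] at hx
    have hx' : x ∈ Icc (-1 : ℝ) 1 := ⟨hx.1.le, hx.2⟩
    rw [norm_mul, Real.norm_eq_abs, Real.norm_eq_abs, abs_of_nonneg (gegenbauer_nonneg hx')]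
    exact mul_le_one₀ (gegenbauer_le_one ha hx') (abs_nonneg _) (Real.abs_cos_le_one _)

/-- Integration by parts for the cosine transform of the Gegenbauer weight. -/
theorem mul_besselF_add_one {a : ℝ} (ha : 0 ≤ a) (t : ℝ) :
    t * besselF (a + 1) t = -2 * (a + 1) * besselF' a t := by
  have hd : ∀ x ∈ uIcc (-1 : ℝ) 1,
      HasDerivAt (fun x => gegenbauer (a + 1) x * Real.sin (t * x))
        (t * (gegenbauer (a + 1) x * Real.cos (t * x))
          - 2 * (a + 1) * (x * gegenbauer a x * Real.sin (t * x))) x := by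
    intro x _
    have h1 : HasDerivAt (fun x : ℝ => 1 - x ^ 2) (-(2 * x)) x := by
      simpa using (hasDerivAt_pow 2 x).const_sub 1
    have h2 : HasDerivAt (gegenbauer (a + 1)) (-(2 * x) * (a + 1) * (1 - x ^ 2) ^ (a + 1 - 1)) x :=
      h1.rpow_const (Or.inr (by linarith))
    have h3 := (Real.hasDerivAt_sin (t * x)).comp x ((hasDerivAt_id x).const_mul t)
    have := h2.mul h3
    refine HasDerivAt.congr_deriv this ?_
    simp [gegenbauer]
    ring
  have hg := continuous_gegenbauer ha
  have hg1 := continuous_gegenbauer (a := a + 1) (by linarith)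
  have i1 : IntervalIntegrable (fun x => t * (gegenbauer (a + 1) x * Real.cos (t * x)))
    volume (-1) 1 := Continuous.intervalIntegrable (by fun_prop) _ _
  have i2 : IntervalIntegrable (fun x => 2 * (a + 1) * (x * gegenbauer a x * Real.sin (t * x)))
    volume (-1) 1 := Continuous.intervalIntegrable (by fun_prop) _ _
  have h := intervalIntegral.integral_eq_sub_of_hasDerivAt hd (i1.sub i2)
  rw [intervalIntegral.integral_sub i1 i2, intervalIntegral.integral_const_mul,
    intervalIntegral.integral_const_mul] at h
  have e1 : gegenbauer (a + 1) 1 = 0 := by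
    simp [gegenbauer, Real.zero_rpow (by linarith : a + 1 ≠ 0)]
  have e2 : gegenbauer (a + 1) (-1) = 0 := by
    simp [gegenbauer, Real.zero_rpow (by linarith : a + 1 ≠ 0)]
  rw [e1, e2] at h
  simp only [besselF, besselF', cosTransform, sinTransform]
  linarith

/-- Differentiating twice produces the factor `-x² = (1 - x²) - 1`, and the factor `1 - x²` raises
the order of the weight by one. Together with `mul_besselF_add_one` this closes up into a
second-order equation for `besselF a` alone. -/
theorem hasDerivAt_besselF' {a : ℝ} (ha : 0 ≤ a) (t : ℝ) :
    HasDerivAt (besselF' a) (besselF (a + 1) t - besselF a t) t := by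
  have hg := continuous_gegenbauer ha
  have hg1 := continuous_gegenbauer (a := a + 1) (by linarith)
  refine HasDerivAt.congr_deriv (hasDerivAt_sinTransform (continuous_id.mul hg) t).neg ?_
  simp only [besselF, cosTransform]
  rw [← intervalIntegral.integral_sub
    (Continuous.intervalIntegrable (by fun_prop) _ _)
    (Continuous.intervalIntegrable (by fun_prop) _ _), ← intervalIntegral.integral_neg]
  refine intervalIntegral.integral_congr fun x hx => ?_
  rw [uIcc_of_le (by norm_num)] at hx
  have : gegenbauer (a + 1) x = gegenbauer a x * (1 - x ^ 2) := by
    rw [gegenbauer, Real.rpow_add_one' (by nlinarith [hx.1, hx.2]) (by linarith)]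
    rfl
  simp only [this, Pi.mul_apply, id]
  ring

/-! ### The normalised Bessel function: differential equation and bounds. -/

/-- The normalised Bessel function `v(t) = t^{a+1} F_a(t)`. -/
def besselV (a t : ℝ) : ℝ := t ^ (a + 1) * besselF a t

/-- The derivative of `besselV`. -/
def besselV' (a t : ℝ) : ℝ := (a + 1) * t ^ a * besselF a t + t ^ (a + 1) * besselF' a t

theorem hasDerivAt_besselV {a t : ℝ} (ha : 0 ≤ a) :
    HasDerivAt (besselV a) (besselV' a t) t := by
  have h := (Real.hasDerivAt_rpow_const (x := t) (p := a + 1) (Or.inr (by linarith))).mul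
    (hasDerivAt_besselF ha t)
  refine HasDerivAt.congr_deriv h ?_
  simp [besselV']

/-- The equation for `F` is `t F'' + 2(a+1) F' + t F = 0`. The power `t^(a+1)` is the one that
removes the first-order term, leaving an oscillator with a perturbation of size `1/t²`. -/
theorem hasDerivAt_besselV' {a t : ℝ} (ha : 0 ≤ a) (ht : 0 < t) :
    HasDerivAt (besselV' a) (a * (a + 1) / t ^ 2 * besselV a t - besselV a t) t := by
  have h1 := ((Real.hasDerivAt_rpow_const (x := t) (p := a) (Or.inl ht.ne')).const_mul
    (a + 1)).mul (hasDerivAt_besselF ha t)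
  have h2 := (Real.hasDerivAt_rpow_const (x := t) (p := a + 1) (Or.inl ht.ne')).mul
    (hasDerivAt_besselF' ha t)
  refine HasDerivAt.congr_deriv (h1.add h2) ?_
  have e1 : t ^ (a - 1) = t ^ a / t := Real.rpow_sub_one ht.ne' a
  have e2 : t ^ (a + 1) = t ^ a * t := Real.rpow_add_one ht.ne' a
  have e3 := mul_besselF_add_one ha t
  simp only [besselV, add_sub_cancel_right]
  rw [e1, e2]
  have e4 : besselF (a + 1) t = -2 * (a + 1) * besselF' a t / t := by
    rw [← e3]; field_simp
  rw [e4]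
  field_simp
  ring

theorem continuous_besselV {a : ℝ} (ha : 0 ≤ a) : Continuous (besselV a) :=
  continuous_iff_continuousAt.2 fun _ => (hasDerivAt_besselV ha).continuousAt

theorem continuous_besselV' {a : ℝ} (ha : 0 ≤ a) : Continuous (besselV' a) := by
  have h1 : Continuous fun t : ℝ => t ^ a := Real.continuous_rpow_const ha
  have h2 : Continuous fun t : ℝ => t ^ (a + 1) := Real.continuous_rpow_const (by linarith)
  exact ((continuous_const.mul h1).mul (continuous_besselF ha)).add
    (h2.mul (continuous_besselF' ha))

theorem besselV_zero {a : ℝ} (ha : 0 ≤ a) : besselV a 0 = 0 := by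
  simp [besselV, Real.zero_rpow (by linarith : a + 1 ≠ 0)]

theorem abs_besselV_le_of_le_one {a t : ℝ} (ha : 0 ≤ a) (h0 : 0 ≤ t) (h1 : t ≤ 1) :
    |besselV a t| ≤ 2 * t := by
  have h : t ^ (a + 1) ≤ t := by
    calc t ^ (a + 1) ≤ t ^ (1 : ℝ) :=
          Real.rpow_le_rpow_of_exponent_ge_of_imp h0 h1 (by linarith) (by intros; linarith)
      _ = t := Real.rpow_one t
  rw [besselV, abs_mul, abs_of_nonneg (Real.rpow_nonneg h0 _)]
  nlinarith [abs_besselF_le ha t, abs_nonneg (besselF a t), Real.rpow_nonneg h0 (a + 1)]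

/-- The energy `v² + v'²`. -/
def besselE (a t : ℝ) : ℝ := besselV a t ^ 2 + besselV' a t ^ 2

theorem continuous_besselE {a : ℝ} (ha : 0 ≤ a) : Continuous (besselE a) :=
  ((continuous_besselV ha).pow 2).add ((continuous_besselV' ha).pow 2)

/-- The equation gives `E' = 2κ v v' / t²`, at most `κ E / t²`. The integrating factor `exp (κ / t)`
turns the derivative into minus a multiple of `(v - v')²`, so `E exp (κ / t)` decreases on `[1, ∞)`;
compactness handles `[0, 1]`. -/
theorem exists_besselE_le {a : ℝ} (ha : 0 ≤ a) : ∃ C, 0 < C ∧ ∀ t, 0 ≤ t → besselE a t ≤ C := by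
  set κ := a * (a + 1) with hκ
  have hκ0 : 0 ≤ κ := by positivity
  have hd : ∀ t : ℝ, 0 < t → HasDerivAt (fun t => besselE a t * Real.exp (κ / t))
      ((2 * κ / t ^ 2 * besselV a t * besselV' a t) * Real.exp (κ / t)
        + besselE a t * (Real.exp (κ / t) * (-(κ / t ^ 2)))) t := by
    intro t ht
    have h1 := ((hasDerivAt_besselV (t := t) ha).pow 2).add ((hasDerivAt_besselV' ha ht).pow 2)
    have h2 : HasDerivAt (fun t : ℝ => κ / t) (-(κ / t ^ 2)) t := by
      have := (hasDerivAt_inv ht.ne').const_mul κ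
      refine HasDerivAt.congr_deriv this ?_
      ring
    refine HasDerivAt.congr_deriv (h1.mul h2.exp) ?_
    simp [besselE, ← hκ]
    ring
  have hanti : AntitoneOn (fun t => besselE a t * Real.exp (κ / t)) (Ici 1) := by
    refine antitoneOn_of_deriv_nonpos (convex_Ici 1)
      (fun t ht => (hd t (by linarith [mem_Ici.1 ht])).continuousAt.continuousWithinAt)
      (fun t ht => ?_) (fun t ht => ?_)
    · rw [interior_Ici] at ht
      exact (hd t (by linarith [mem_Ioi.1 ht])).differentiableAt.differentiableWithinAt
    · rw [interior_Ici] at ht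
      have ht0 : 0 < t := by linarith [mem_Ioi.1 ht]
      rw [(hd t ht0).deriv]
      have : (2 * κ / t ^ 2 * besselV a t * besselV' a t) * Real.exp (κ / t)
        + besselE a t * (Real.exp (κ / t) * (-(κ / t ^ 2)))
        = -(κ / t ^ 2 * Real.exp (κ / t) * (besselV a t - besselV' a t) ^ 2) := by
        rw [besselE]; ring
      rw [this]
      have : 0 ≤ κ / t ^ 2 * Real.exp (κ / t) * (besselV a t - besselV' a t) ^ 2 := by positivity
      linarith
  obtain ⟨C, hC⟩ := isCompact_Icc.exists_bound_of_continuousOn (s := Icc (0 : ℝ) 1)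
    (continuous_besselE ha).continuousOn
  -- The `+ 1` only makes the constant strictly positive.
  refine ⟨max C (besselE a 1 * Real.exp (κ / 1)) + 1, ?_, fun t ht => ?_⟩
  · have : 0 ≤ C := (norm_nonneg _).trans (hC 0 ⟨le_rfl, zero_le_one⟩)
    have := le_max_left C (besselE a 1 * Real.exp (κ / 1))
    linarith
  · rcases le_total t 1 with h | h
    · have := (le_abs_self _).trans (hC t ⟨ht, h⟩)
      have := le_max_left C (besselE a 1 * Real.exp (κ / 1))
      linarith
    · have h1 := hanti (mem_Ici.2 le_rfl) (mem_Ici.2 h) h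
      have h2 : besselE a t ≤ besselE a t * Real.exp (κ / t) :=
        le_mul_of_one_le_right (by unfold besselE; positivity) (Real.one_le_exp (by positivity))
      have := le_max_right C (besselE a 1 * Real.exp (κ / 1))
      simp only at h1
      linarith

theorem exists_abs_besselV_le {a : ℝ} (ha : 0 ≤ a) :
    ∃ C, 0 < C ∧ ∀ t, 0 ≤ t → |besselV a t| ≤ C ∧ |besselV' a t| ≤ C ∧ |besselV a t| ≤ C * t := by
  obtain ⟨C, hC0, hC⟩ := exists_besselE_le ha
  have hv : ∀ t, 0 ≤ t → |besselV a t| ≤ C + 2 ∧ |besselV' a t| ≤ C + 2 := by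
    intro t ht
    have := hC t ht
    rw [besselE] at this
    constructor <;> refine abs_le_of_sq_le_sq ?_ (by linarith) <;>
      nlinarith [sq_nonneg (besselV a t), sq_nonneg (besselV' a t)]
  -- The constant `C + 2` dominates the square root of the energy bound `C`, and its `2` absorbs the
  -- bound `2 * t` valid on `[0, 1]`. For `t ≥ 1` the linear bound follows from the constant one.
  refine ⟨C + 2, by linarith, fun t ht => ⟨(hv t ht).1, (hv t ht).2, ?_⟩⟩
  rcases le_total t 1 with h | h
  · exact (abs_besselV_le_of_le_one ha ht h).trans (by nlinarith)
  · exact (hv t ht).1.trans (by nlinarith)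

/-! ### Abel and Cesàro limits. -/

/-- Abel's theorem for Laplace transforms. -/
theorem tendsto_mul_laplace {f : ℝ → ℂ} (hf : Measurable f) {C : ℝ} (hC : ∀ t, 0 < t → ‖f t‖ ≤ C)
    {L : ℂ} (hL : Tendsto f atTop (𝓝 L)) :
    Tendsto (fun s : ℝ => (s : ℂ) * ∫ t in Ioi (0 : ℝ), Complex.exp (-(s * t)) * f t)
      (𝓝[>] 0) (𝓝 L) := by
  -- The substitution `x = s t` gives an average against the fixed probability density `exp (-x)`,
  -- so that `s` enters only through the argument `x / s → ∞`.
  have h1 : ∀ᶠ s : ℝ in 𝓝[>] 0, ∫ x in Ioi (0 : ℝ), (Real.exp (-x) : ℂ) * f (x / s)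
      = (s : ℂ) * ∫ t in Ioi (0 : ℝ), Complex.exp (-(s * t)) * f t := by
    filter_upwards [self_mem_nhdsWithin] with s (hs : 0 < s)
    have := integral_comp_mul_left_Ioi (fun x => (Real.exp (-x) : ℂ) * f (x / s)) 0 hs
    rw [mul_zero] at this
    have h2 : ∀ x, s * x / s = x := fun x => by field_simp
    simp only [h2] at this
    have h3 : ∀ x : ℝ, ((Real.exp (-(s * x)) : ℝ) : ℂ) = Complex.exp (-(s * x)) := by
      intro x; push_cast; rfl
    simp only [h3] at this
    rw [this, Complex.real_smul, ← mul_assoc]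
    push_cast
    rw [mul_inv_cancel₀ (by exact_mod_cast hs.ne'), one_mul]
  refine Tendsto.congr' h1 ?_
  have h4 : L = ∫ x in Ioi (0 : ℝ), (Real.exp (-x) : ℂ) * L := by
    rw [integral_mul_const, integral_complex_ofReal, integral_exp_neg_Ioi_zero]
    simp
  conv => rhs; rw [h4]
  refine tendsto_integral_filter_of_dominated_convergence (fun x => Real.exp (-x) * C)
    (.of_forall fun s => ?_) ?_ ?_ ?_
  · exact (Measurable.aestronglyMeasurable (by fun_prop))
  · filter_upwards [self_mem_nhdsWithin] with s (hs : 0 < s)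
    refine (ae_restrict_iff' measurableSet_Ioi).2 (.of_forall fun x (hx : 0 < x) => ?_)
    rw [norm_mul, Complex.norm_real, Real.norm_eq_abs, abs_of_pos (Real.exp_pos _)]
    exact mul_le_mul_of_nonneg_left (hC _ (by positivity)) (Real.exp_pos _).le
  · exact (integrableOn_exp_neg_Ioi 0).mul_const C
  · refine (ae_restrict_iff' measurableSet_Ioi).2 (.of_forall fun x (hx : 0 < x) => ?_)
    refine Tendsto.const_mul _ (hL.comp ?_)
    have h5 : Tendsto (fun s : ℝ => x * s⁻¹) (𝓝[>] 0) atTop :=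
      tendsto_inv_nhdsGT_zero.const_mul_atTop hx
    exact h5

/-- A bounded function with a limit at infinity has the same limit in the Cesàro sense. -/
theorem tendsto_cesaro_integral {f : ℝ → ℝ} (hf : Measurable f) {C : ℝ}
    (hC : ∀ t, 0 < t → |f t| ≤ C) {L : ℝ} (hL : Tendsto f atTop (𝓝 L)) :
    Tendsto (fun T : ℝ => 1 / T * ∫ t in (0 : ℝ)..T, f t) atTop (𝓝 L) := by
  have h1 : ∀ᶠ T : ℝ in atTop, ∫ u in (0 : ℝ)..1, f (T * u) = 1 / T * ∫ t in (0 : ℝ)..T, f t := by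
    filter_upwards [eventually_gt_atTop 0] with T hT
    rw [intervalIntegral.integral_comp_mul_left _ hT.ne', mul_zero, mul_one, smul_eq_mul, one_div]
  refine Tendsto.congr' h1 ?_
  have h2 : L = ∫ u in (0 : ℝ)..1, L := by simp
  conv => rhs; rw [h2]
  refine intervalIntegral.tendsto_integral_filter_of_dominated_convergence (fun _ => C)
    (.of_forall fun T => ?_) ?_ (by simp) ?_
  · exact (Measurable.aestronglyMeasurable (by fun_prop))
  · filter_upwards [eventually_gt_atTop 0] with T hT
    refine .of_forall fun u hu => ?_
    rw [uIoc_of_le zero_le_one] at hu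
    exact hC _ (mul_pos hT hu.1)
  · refine .of_forall fun u hu => ?_
    rw [uIoc_of_le zero_le_one] at hu
    exact hL.comp (tendsto_id.atTop_mul_const hu.1)

/-! ### Limiting amplitude and mean square. -/

/-- The demodulated complex amplitude `(v' + i v) e^{-it}`. -/
def besselW (a t : ℝ) : ℂ :=
  ((besselV' a t : ℂ) + Complex.I * besselV a t) * Complex.exp (-(Complex.I * t))

theorem hasDerivAt_besselW {a t : ℝ} (ha : 0 ≤ a) (ht : 0 < t) :
    HasDerivAt (besselW a)
      (((a * (a + 1) / t ^ 2 * besselV a t : ℝ) : ℂ) * Complex.exp (-(Complex.I * t))) t := by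
  have h1 := (hasDerivAt_besselV' ha ht).ofReal_comp
  have h2 := ((hasDerivAt_besselV (t := t) ha).ofReal_comp).const_mul Complex.I
  have h3 : HasDerivAt (fun t : ℝ => Complex.exp (-(Complex.I * t)))
      (Complex.exp (-(Complex.I * t)) * (-Complex.I)) t := by
    have := ((((hasDerivAt_id t).ofReal_comp).const_mul Complex.I).neg).cexp
    refine HasDerivAt.congr_deriv this ?_
    simp
  refine HasDerivAt.congr_deriv ((h1.add h2).mul h3) ?_
  simp only [Pi.add_apply]
  push_cast
  linear_combination (-(besselV a t : ℂ) * Complex.exp (-(Complex.I * t))) * Complex.I_sq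

theorem continuous_besselW {a : ℝ} (ha : 0 ≤ a) : Continuous (besselW a) := by
  have h1 := continuous_besselV ha
  have h2 := continuous_besselV' ha
  unfold besselW
  fun_prop

theorem norm_besselW_sq (a t : ℝ) : ‖besselW a t‖ ^ 2 = besselE a t := by
  have h : ‖Complex.exp (-(Complex.I * t))‖ = 1 := by
    rw [Complex.norm_exp]; simp
  rw [besselW, norm_mul, h, mul_one, mul_comm Complex.I, ← Complex.normSq_eq_norm_sq,
    Complex.normSq_add_mul_I, besselE]
  ring

theorem norm_exp_neg_I_mul (t : ℝ) : ‖Complex.exp (-(Complex.I * t))‖ = 1 := by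
  rw [Complex.norm_exp]; simp

/-- Demodulation cancels the free oscillation: only the perturbation `κ v / t²` survives in the
derivative, and it is integrable at infinity because `v` is bounded. -/
theorem exists_tendsto_besselW {a : ℝ} (ha : 0 ≤ a) : ∃ W, Tendsto (besselW a) atTop (𝓝 W) := by
  obtain ⟨C, hC0, hC⟩ := exists_abs_besselV_le ha
  refine ⟨_, tendsto_limUnder_of_hasDerivAt_of_integrableOn_Ioi (a := 1)
    (fun t ht => hasDerivAt_besselW ha (zero_lt_one.trans ht)) ?_⟩
  have hi : IntegrableOn (fun t : ℝ => a * (a + 1) * C * t ^ (-2 : ℝ)) (Ioi 1) :=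
    (integrableOn_Ioi_rpow_of_lt (by norm_num) zero_lt_one).const_mul _
  refine Integrable.mono' hi ?_ ?_
  · have h := (continuous_besselV ha).measurable
    exact (Measurable.aestronglyMeasurable (by fun_prop))
  · refine (ae_restrict_iff' measurableSet_Ioi).2 (.of_forall fun t (ht : 1 < t) => ?_)
    have ht0 : 0 < t := by linarith
    rw [norm_mul, norm_exp_neg_I_mul, mul_one, Complex.norm_real, Real.norm_eq_abs, abs_mul,
      abs_of_nonneg (by positivity), Real.rpow_neg ht0.le, Real.rpow_two]
    have := (hC t ht0.le).1
    calc a * (a + 1) / t ^ 2 * |besselV a t| ≤ a * (a + 1) / t ^ 2 * C := by gcongr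
      _ = _ := by ring

/-- The mean of `v²` is half the limiting energy. -/
theorem tendsto_cesaro_besselV_sq {a : ℝ} (ha : 0 ≤ a) {W : ℂ}
    (hW : Tendsto (besselW a) atTop (𝓝 W)) :
    Tendsto (fun T : ℝ => 1 / T * ∫ t in (0 : ℝ)..T, besselV a t ^ 2) atTop
      (𝓝 (‖W‖ ^ 2 / 2)) := by
  obtain ⟨C, hC0, hC⟩ := exists_abs_besselV_le ha
  have hv := continuous_besselV ha
  have hv' := continuous_besselV' ha
  have hE := continuous_besselE ha
  set κ := a * (a + 1) with hκ
  have hκ0 : 0 ≤ κ := by positivity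
  -- The differential equation gives `(v v' / 2)' = k - v²`. Hence `v²` and `k` have the same mean
  -- up to a bounded boundary term divided by `T`, and unlike `v²` the function `k` converges.
  set k : ℝ → ℝ := fun t => besselE a t / 2 + κ / 2 * (besselV a t ^ 2 / t ^ 2) with hk
  have hkm : Measurable k := by
    have := hv.measurable; have := hE.measurable
    fun_prop
  -- The linear bound `|v| ≤ C t` is what controls the quotient near `t = 0`.
  have hq : ∀ t, 0 < t → besselV a t ^ 2 / t ^ 2 ≤ C ^ 2 := by
    intro t ht
    rw [← div_pow, ← sq_abs, abs_div, abs_of_pos ht]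
    have := (hC t ht.le).2.2
    exact pow_le_pow_left₀ (by positivity) ((div_le_iff₀ ht).2 this) 2
  have hkb : ∀ t, 0 < t → |k t| ≤ C ^ 2 + κ / 2 * C ^ 2 := by
    intro t ht
    have h1 := hq t ht
    have h2 : besselE a t ≤ 2 * C ^ 2 := by
      rw [besselE, ← sq_abs, ← sq_abs (besselV' a t)]
      have := pow_le_pow_left₀ (abs_nonneg _) (hC t ht.le).1 2
      have := pow_le_pow_left₀ (abs_nonneg _) (hC t ht.le).2.1 2
      linarith
    have h3 : 0 ≤ besselE a t := by unfold besselE; positivity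
    rw [abs_of_nonneg (by positivity)]
    have := mul_le_mul_of_nonneg_left h1 (by positivity : 0 ≤ κ / 2)
    simp only [hk]
    linarith
  have hkl : Tendsto k atTop (𝓝 (‖W‖ ^ 2 / 2)) := by
    have h1 : Tendsto (fun t => besselE a t / 2) atTop (𝓝 (‖W‖ ^ 2 / 2)) := by
      have := (hW.norm.pow 2).div_const 2
      simpa only [norm_besselW_sq] using this
    have h2 : Tendsto (fun t => κ / 2 * (besselV a t ^ 2 / t ^ 2)) atTop (𝓝 0) := by
      have h3 : Tendsto (fun t : ℝ => κ / 2 * (C ^ 2 / t ^ 2)) atTop (𝓝 0) := by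
        have := (tendsto_const_nhds (x := C ^ 2)).div_atTop
          (tendsto_pow_atTop (α := ℝ) (two_ne_zero))
        simpa using this.const_mul (κ / 2)
      refine squeeze_zero' (.of_forall fun t => by positivity) ?_ h3
      filter_upwards [eventually_gt_atTop 0] with t ht
      have := pow_le_pow_left₀ (abs_nonneg _) (hC t ht.le).1 2
      rw [sq_abs] at this
      gcongr
    simpa using h1.add h2
  have hces := tendsto_cesaro_integral hkm hkb hkl
  have hint : ∀ T, 0 < T → IntervalIntegrable k volume 0 T := by
    intro T hT
    rw [intervalIntegrable_iff_integrableOn_Ioc_of_le hT.le]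
    refine Measure.integrableOn_of_bounded (M := C ^ 2 + κ / 2 * C ^ 2) (by simp)
      hkm.aestronglyMeasurable ?_
    exact (ae_restrict_iff' measurableSet_Ioc).2 (.of_forall fun t ht => hkb t ht.1)
  have hftc : ∀ T, 0 < T → ∫ t in (0 : ℝ)..T, besselV a t ^ 2
      = (∫ t in (0 : ℝ)..T, k t) - besselV a T * besselV' a T / 2 := by
    intro T hT
    have hi2 : IntervalIntegrable (fun t => besselV a t ^ 2) volume 0 T :=
      (hv.pow 2).intervalIntegrable _ _
    have := intervalIntegral.integral_eq_sub_of_hasDerivAt_of_le hT.le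
      (f := fun t => besselV a t * besselV' a t / 2) (f' := fun t => k t - besselV a t ^ 2)
      (by fun_prop) (fun t ht => ?_) ((hint T hT).sub hi2)
    · rw [intervalIntegral.integral_sub (hint T hT) hi2, besselV_zero ha] at this
      linarith
    · refine HasDerivAt.congr_deriv
        (((hasDerivAt_besselV (t := t) ha).mul (hasDerivAt_besselV' ha ht.1)).div_const 2) ?_
      simp only [hk, besselE, ← hκ]
      ring
  have hrem : Tendsto (fun T : ℝ => 1 / T * (besselV a T * besselV' a T / 2)) atTop (𝓝 0) := by
    have h3 : Tendsto (fun T : ℝ => 1 / T * (C * C / 2)) atTop (𝓝 0) := by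
      have := (tendsto_inv_atTop_zero (𝕜 := ℝ)).mul_const (C * C / 2)
      simpa using this
    refine squeeze_zero_norm' ?_ h3
    filter_upwards [eventually_gt_atTop 0] with T hT
    rw [Real.norm_eq_abs, abs_mul, abs_of_pos (by positivity : 0 < 1 / T), abs_div, abs_mul,
      abs_of_pos (by norm_num : (0 : ℝ) < 2)]
    have h1 := (hC T hT.le).1
    have h2 := (hC T hT.le).2.1
    gcongr
  have := hces.sub hrem
  rw [sub_zero] at this
  refine this.congr' ?_
  filter_upwards [eventually_gt_atTop 0] with T hT
  rw [hftc T hT]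
  ring

/-! ### Laplace transforms and the value of the amplitude. -/

theorem ofReal_mul_cpow {r : ℝ} (hr : 0 < r) {z : ℂ} (hz : z ≠ 0) (c : ℝ) :
    ((r : ℂ) * z) ^ (c : ℂ) = ((r ^ c : ℝ) : ℂ) * z ^ (c : ℂ) := by
  have hr' : (r : ℂ) ≠ 0 := by exact_mod_cast hr.ne'
  rw [Complex.cpow_def_of_ne_zero (mul_ne_zero hr' hz), Complex.cpow_def_of_ne_zero hz,
    Complex.log_ofReal_mul hr hz, add_mul, Complex.exp_add, Real.rpow_def_of_pos hr]
  push_cast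
  rfl

theorem cpow_add_one {z : ℂ} (hz : z ≠ 0) (c : ℂ) : z ^ (c + 1) = z ^ c * z := by
  rw [Complex.cpow_add _ _ hz, Complex.cpow_one]

theorem integrableOn_rpow_mul_exp_neg {p s : ℝ} (hp : 0 ≤ p) (hs : 0 < s) :
    IntegrableOn (fun t : ℝ => t ^ p * Real.exp (-(s * t))) (Ioi 0) := by
  have := integrableOn_rpow_mul_exp_neg_mul_rpow (p := 1) (s := p) (b := s) (by linarith) one_pos hs
  simpa [Real.rpow_one] using this

theorem norm_cexp_neg_mul (z : ℂ) (t : ℝ) :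
    ‖Complex.exp (-(z * t))‖ = Real.exp (-(z.re * t)) := by
  rw [Complex.norm_exp]; simp

theorem integrableOn_rpow_mul_cexp_neg {p : ℝ} {z : ℂ} (hp : 0 ≤ p) (hz : 0 < z.re) :
    IntegrableOn (fun t : ℝ => ((t ^ p : ℝ) : ℂ) * Complex.exp (-(z * t))) (Ioi 0) := by
  refine Integrable.mono' (integrableOn_rpow_mul_exp_neg hp hz)
    (Measurable.aestronglyMeasurable (by fun_prop)) ?_
  refine (ae_restrict_iff' measurableSet_Ioi).2 (.of_forall fun t (ht : 0 < t) => ?_)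
  rw [norm_mul, norm_cexp_neg_mul, Complex.norm_real, Real.norm_eq_abs,
    abs_of_nonneg (Real.rpow_nonneg ht.le _)]

theorem tendsto_rpow_mul_cexp_neg {p : ℝ} {z : ℂ} (hz : 0 < z.re) :
    Tendsto (fun t : ℝ => ((t ^ p : ℝ) : ℂ) * Complex.exp (-(z * t))) atTop (𝓝 0) := by
  refine squeeze_zero_norm' ?_ (tendsto_rpow_mul_exp_neg_mul_atTop_nhds_zero p z.re hz)
  filter_upwards [eventually_gt_atTop 0] with t ht
  rw [norm_mul, norm_cexp_neg_mul, Complex.norm_real, Real.norm_eq_abs,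
    abs_of_nonneg (Real.rpow_nonneg ht.le _), neg_mul]

theorem hasDerivAt_cexp_neg_mul (z : ℂ) (t : ℝ) :
    HasDerivAt (fun t : ℝ => Complex.exp (-(z * t))) (-z * Complex.exp (-(z * t))) t := by
  have := ((((hasDerivAt_id t).ofReal_comp).const_mul z).neg).cexp
  refine HasDerivAt.congr_deriv this ?_
  simp [mul_comm]

/-- Recursion for the Laplace transform of a power. -/
theorem mul_integral_rpow_add_one {p : ℝ} {z : ℂ} (hp : 0 ≤ p) (hz : 0 < z.re) :
    z * ∫ t in Ioi (0 : ℝ), ((t ^ (p + 1) : ℝ) : ℂ) * Complex.exp (-(z * t))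
      = (p + 1) * ∫ t in Ioi (0 : ℝ), ((t ^ p : ℝ) : ℂ) * Complex.exp (-(z * t)) := by
  have i1 := (integrableOn_rpow_mul_cexp_neg hp hz).const_mul ((p : ℂ) + 1)
  have i2 := (integrableOn_rpow_mul_cexp_neg (p := p + 1) (by linarith) hz).const_mul z
  have hd : ∀ t : ℝ, HasDerivAt (fun t : ℝ => ((t ^ (p + 1) : ℝ) : ℂ) * Complex.exp (-(z * t)))
      (((p : ℂ) + 1) * (((t ^ p : ℝ) : ℂ) * Complex.exp (-(z * t)))
        - z * (((t ^ (p + 1) : ℝ) : ℂ) * Complex.exp (-(z * t)))) t := by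
    intro t
    have h1 := (Real.hasDerivAt_rpow_const (x := t) (p := p + 1) (Or.inr (by linarith))).ofReal_comp
    refine HasDerivAt.congr_deriv (h1.mul (hasDerivAt_cexp_neg_mul z t)) ?_
    simp only [add_sub_cancel_right]
    push_cast
    ring
  have h := integral_Ioi_of_hasDerivAt_of_tendsto' (a := 0) (fun t _ => hd t) (i1.sub i2)
    (tendsto_rpow_mul_cexp_neg hz)
  rw [integral_sub i1 i2, integral_const_mul, integral_const_mul,
    Real.zero_rpow (by linarith : p + 1 ≠ 0)] at h
  simp only [Complex.ofReal_zero, zero_mul, sub_zero] at h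
  exact (sub_eq_zero.1 h).symm

/-- No contour shift is needed. By `mul_integral_rpow_add_one`, the integral times `(s + iy)^(p+1)`
has zero derivative in `y`, hence equals its value at `y = 0`, which is the real Gamma integral. -/
theorem laplace_rpow {p s : ℝ} (hp : 0 ≤ p) (hs : 0 < s) (y : ℝ) :
    ∫ t in Ioi (0 : ℝ), ((t ^ p : ℝ) : ℂ) * Complex.exp (-((s + Complex.I * y : ℂ) * t))
      = Real.Gamma (p + 1) * (s + Complex.I * y : ℂ) ^ ((-(p + 1) : ℝ) : ℂ) := by
  have hre : ∀ y : ℝ, (s + Complex.I * y : ℂ).re = s := by intro y; simp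
  have hz0 : ∀ y : ℝ, (s + Complex.I * y : ℂ) ≠ 0 := by
    intro y h
    have := congrArg Complex.re h
    rw [hre] at this
    exact hs.ne' this
  set Φ : ℝ → ℂ := fun y =>
    ∫ t in Ioi (0 : ℝ), ((t ^ p : ℝ) : ℂ) * Complex.exp (-((s + Complex.I * y : ℂ) * t)) with hΦ
  have hΦd : ∀ y : ℝ, HasDerivAt Φ (-Complex.I * ∫ t in Ioi (0 : ℝ),
      ((t ^ (p + 1) : ℝ) : ℂ) * Complex.exp (-((s + Complex.I * y : ℂ) * t))) y := by
    intro y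
    have h := (hasDerivAt_integral_of_dominated_loc_of_deriv_le (μ := volume.restrict (Ioi 0))
      (F := fun (y t : ℝ) => ((t ^ p : ℝ) : ℂ) * Complex.exp (-((s + Complex.I * y : ℂ) * t)))
      (F' := fun (y t : ℝ) => -Complex.I * (((t ^ (p + 1) : ℝ) : ℂ) *
        Complex.exp (-((s + Complex.I * y : ℂ) * t)))) (x₀ := y) (s := univ)
      (bound := fun t => t ^ (p + 1) * Real.exp (-(s * t))) univ_mem
      (.of_forall fun y => (Measurable.aestronglyMeasurable (by fun_prop)))
      (integrableOn_rpow_mul_cexp_neg hp (by rw [hre]; exact hs))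
      (Measurable.aestronglyMeasurable (by fun_prop))
      ?_ (integrableOn_rpow_mul_exp_neg (by linarith) hs) ?_).2
    · refine HasDerivAt.congr_deriv h ?_
      rw [integral_const_mul]
    · refine (ae_restrict_iff' measurableSet_Ioi).2 (.of_forall fun t (ht : 0 < t) y _ => ?_)
      rw [norm_mul, norm_mul, norm_cexp_neg_mul, hre, Complex.norm_real, Real.norm_eq_abs,
        abs_of_nonneg (Real.rpow_nonneg ht.le _), norm_neg, Complex.norm_I, one_mul]
    · refine (ae_restrict_iff' measurableSet_Ioi).2 (.of_forall fun t (ht : 0 < t) y _ => ?_)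
      have h1 : HasDerivAt (fun y : ℝ => -((s + Complex.I * y : ℂ) * t)) (-(Complex.I * t)) y := by
        have := (((((hasDerivAt_id y).ofReal_comp).const_mul Complex.I).const_add (s : ℂ)).mul_const
          (t : ℂ)).neg
        refine HasDerivAt.congr_deriv this ?_
        simp
      refine HasDerivAt.congr_deriv (h1.cexp.const_mul _) ?_
      rw [Real.rpow_add_one ht.ne']
      push_cast
      ring
  have hcd : ∀ y : ℝ, HasDerivAt (fun y : ℝ => Φ y * (s + Complex.I * y : ℂ) ^ ((p + 1 : ℝ) : ℂ))
      0 y := by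
    intro y
    have h1 : HasDerivAt (fun y : ℝ => (s + Complex.I * y : ℂ)) Complex.I y := by
      have := (((hasDerivAt_id y).ofReal_comp).const_mul Complex.I).const_add (s : ℂ)
      refine HasDerivAt.congr_deriv this ?_
      simp
    have h2 := ((hasDerivAt_id (s + Complex.I * y : ℂ)).cpow_const (c := ((p + 1 : ℝ) : ℂ))
      (Or.inl (by rw [id, hre]; exact hs))).comp y h1
    refine HasDerivAt.congr_deriv ((hΦd y).mul h2) ?_
    have h3 := mul_integral_rpow_add_one hp (z := s + Complex.I * y) (by rw [hre]; exact hs)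
    have h4 : (s + Complex.I * y : ℂ) ^ ((p + 1 : ℝ) : ℂ)
        = (s + Complex.I * y : ℂ) ^ (((p + 1 : ℝ) : ℂ) - 1) * (s + Complex.I * y) := by
      rw [← cpow_add_one (hz0 y), sub_add_cancel]
    rw [h4]
    simp only [hΦ, id]
    set J := ∫ t in Ioi (0 : ℝ),
      ((t ^ (p + 1) : ℝ) : ℂ) * Complex.exp (-((s + Complex.I * y : ℂ) * t))
    set J0 := ∫ t in Ioi (0 : ℝ), ((t ^ p : ℝ) : ℂ) * Complex.exp (-((s + Complex.I * y : ℂ) * t))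
    push_cast
    linear_combination (-Complex.I * (s + Complex.I * y : ℂ) ^ ((p : ℂ) + 1 - 1)) * h3
  have hconst := is_const_of_deriv_eq_zero (fun y => (hcd y).differentiableAt)
    (fun y => (hcd y).deriv) y 0
  have h0 : Φ 0 = Real.Gamma (p + 1) * ((s ^ (-(p + 1)) : ℝ) : ℂ) := by
    have := Real.integral_rpow_mul_exp_neg_mul_Ioi (a := p + 1) (r := s) (by linarith) hs
    simp only [add_sub_cancel_right] at this
    have h1 : Φ 0 = ((∫ t in Ioi (0 : ℝ), t ^ p * Real.exp (-(s * t)) : ℝ) : ℂ) := by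
      rw [← integral_complex_ofReal]
      simp [hΦ]
    rw [h1, this, Real.rpow_neg hs.le, one_div, Real.inv_rpow hs.le]
    push_cast
    ring
  have h1 : (s : ℂ) ^ ((p + 1 : ℝ) : ℂ) = ((s ^ (p + 1) : ℝ) : ℂ) := by
    rw [Complex.ofReal_cpow hs.le]
  have hne : (s + Complex.I * y : ℂ) ^ ((p + 1 : ℝ) : ℂ) ≠ 0 := by
    rw [Complex.cpow_def_of_ne_zero (hz0 y)]
    exact Complex.exp_ne_zero _
  simp only [Complex.ofReal_zero, mul_zero, add_zero] at hconst
  rw [h1, h0, mul_assoc, ← Complex.ofReal_mul, ← Real.rpow_add hs, neg_add_cancel,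
    Real.rpow_zero, Complex.ofReal_one, mul_one] at hconst
  rw [Complex.ofReal_neg, Complex.cpow_neg, ← hconst]
  field_simp
  rfl

theorem one_add_I_mul_ne_zero (u : ℝ) : (1 + Complex.I * u : ℂ) ≠ 0 := by
  intro h
  have := congrArg Complex.re h
  simp at this

theorem le_norm_one_add_I_mul (u : ℝ) : u ≤ ‖(1 + Complex.I * u : ℂ)‖ := by
  have := Complex.abs_im_le_norm (1 + Complex.I * u)
  simp only [Complex.add_im, Complex.one_im, Complex.mul_im, Complex.I_re, Complex.ofReal_im,
    Complex.I_im, Complex.ofReal_re] at this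
  exact (le_abs_self u).trans (by simpa using this)

theorem continuous_one_add_I_mul_cpow (c : ℝ) :
    Continuous fun u : ℝ => (1 + Complex.I * u : ℂ) ^ (c : ℂ) := by
  refine continuous_iff_continuousAt.2 fun u => ?_
  exact ContinuousAt.cpow (by fun_prop) continuousAt_const (Or.inl (by simp))

/-- The function is continuous on `[0, 1]`, and beyond `1` the inequality `|1 + iu| ≥ u` bounds it
by `u⁻²`. It also serves as majorant for the rescaled Laplace integrals. -/
theorem integrableOn_rpow_mul_one_add_I {a : ℝ} (ha : 0 ≤ a) :
    IntegrableOn (fun u : ℝ => u ^ a * ‖(1 + Complex.I * u : ℂ)‖ ^ (-(a + 2))) (Ioi 0) := by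
  have hm : Continuous fun u : ℝ => u ^ a * ‖(1 + Complex.I * u : ℂ)‖ ^ (-(a + 2)) := by
    refine (Real.continuous_rpow_const ha).mul (Continuous.rpow_const (by fun_prop) fun u => ?_)
    exact Or.inl (norm_ne_zero_iff.2 (one_add_I_mul_ne_zero u))
  rw [← Ioc_union_Ioi_eq_Ioi zero_le_one]
  refine IntegrableOn.union
    ((hm.integrableOn_Icc (a := 0) (b := 1)).mono_set Ioc_subset_Icc_self) ?_
  refine Integrable.mono' (integrableOn_Ioi_rpow_of_lt (a := -2) (by norm_num) zero_lt_one)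
    hm.aestronglyMeasurable ?_
  refine (ae_restrict_iff' measurableSet_Ioi).2 (.of_forall fun u (hu : 1 < u) => ?_)
  have hu0 : 0 < u := by linarith
  rw [Real.norm_eq_abs, abs_of_nonneg (by positivity)]
  calc u ^ a * ‖(1 + Complex.I * u : ℂ)‖ ^ (-(a + 2)) ≤ u ^ a * u ^ (-(a + 2)) := by
        gcongr u ^ a * ?_
        exact Real.rpow_le_rpow_of_nonpos hu0 (le_norm_one_add_I_mul u) (by linarith)
    _ = u ^ (-2 : ℝ) := by rw [← Real.rpow_add hu0]; ring_nf

/-- A Beta-type integral, evaluated through an explicit primitive. -/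
theorem integral_rpow_mul_one_add_I {a : ℝ} (ha : 0 ≤ a) :
    ∫ u in Ioi (0 : ℝ), ((u ^ a : ℝ) : ℂ) * (1 + Complex.I * u : ℂ) ^ ((-(a + 2) : ℝ) : ℂ)
      = Complex.I ^ ((-(a + 1) : ℝ) : ℂ) / (a + 1) := by
  have ha1 : ((a : ℂ) + 1) ≠ 0 := by
    have : a + 1 ≠ 0 := by linarith
    exact_mod_cast this
  have hd : ∀ u : ℝ, 0 < u → HasDerivAt (fun u : ℝ => ((u ^ (a + 1) : ℝ) : ℂ) *
      (1 + Complex.I * u : ℂ) ^ ((-(a + 1) : ℝ) : ℂ) / (a + 1))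
      (((u ^ a : ℝ) : ℂ) * (1 + Complex.I * u : ℂ) ^ ((-(a + 2) : ℝ) : ℂ)) u := by
    intro u hu
    have h1 := (Real.hasDerivAt_rpow_const (x := u) (p := a + 1) (Or.inr (by linarith))).ofReal_comp
    have h2 : HasDerivAt (fun y : ℝ => (1 + Complex.I * y : ℂ)) Complex.I u := by
      have := (((hasDerivAt_id u).ofReal_comp).const_mul Complex.I).const_add (1 : ℂ)
      refine HasDerivAt.congr_deriv this ?_
      simp
    have h3 := ((hasDerivAt_id (1 + Complex.I * u : ℂ)).cpow_const
      (c := ((-(a + 1) : ℝ) : ℂ)) (Or.inl (by simp))).comp u h2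
    refine HasDerivAt.congr_deriv ((h1.mul h3).div_const _) ?_
    have e1 : (1 + Complex.I * u : ℂ) ^ ((-(a + 1) : ℝ) : ℂ)
        = (1 + Complex.I * u : ℂ) ^ ((-(a + 2) : ℝ) : ℂ) * (1 + Complex.I * u) := by
      rw [← cpow_add_one (one_add_I_mul_ne_zero u)]
      congr 1
      push_cast
      ring
    have e2 : (((-(a + 1) : ℝ) : ℂ) - 1) = ((-(a + 2) : ℝ) : ℂ) := by push_cast; ring
    have e3 : u ^ (a + 1) = u ^ a * u := Real.rpow_add_one hu.ne' a
    simp only [id, Function.comp_apply, add_sub_cancel_right]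
    rw [e2, e1, e3]
    push_cast
    field_simp
    ring
  have hi : IntegrableOn (fun u : ℝ => ((u ^ a : ℝ) : ℂ) *
      (1 + Complex.I * u : ℂ) ^ ((-(a + 2) : ℝ) : ℂ)) (Ioi 0) := by
    refine Integrable.mono' (integrableOn_rpow_mul_one_add_I ha) ?_ ?_
    · have h1 := (continuous_one_add_I_mul_cpow (-(a + 2))).measurable
      exact (Measurable.aestronglyMeasurable (by fun_prop))
    · refine (ae_restrict_iff' measurableSet_Ioi).2 (.of_forall fun u (hu : 0 < u) => ?_)
      rw [norm_mul, Complex.norm_real, Complex.norm_cpow_real, Real.norm_eq_abs,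
        abs_of_nonneg (by positivity)]
  have hl : Tendsto (fun u : ℝ => ((u ^ (a + 1) : ℝ) : ℂ) *
      (1 + Complex.I * u : ℂ) ^ ((-(a + 1) : ℝ) : ℂ) / (a + 1)) atTop
      (𝓝 (Complex.I ^ ((-(a + 1) : ℝ) : ℂ) / (a + 1))) := by
    refine Tendsto.div_const ?_ _
    have h1 : Tendsto (fun u : ℝ => ((u⁻¹ : ℝ) : ℂ) + Complex.I) atTop (𝓝 Complex.I) := by
      have := ((Complex.continuous_ofReal.tendsto 0).comp
        (tendsto_inv_atTop_zero (𝕜 := ℝ))).add_const Complex.I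
      simpa using this
    have h2 := h1.cpow (tendsto_const_nhds (x := ((-(a + 1) : ℝ) : ℂ))) (Or.inr (by simp))
    refine h2.congr' ?_
    filter_upwards [eventually_gt_atTop 0] with u hu
    -- Pulling out the positive factor `u` is compatible with the principal branch and cancels
    -- `u^(a+1)`; the remaining base tends to `i`, which lies off the cut.
    have e : (1 + Complex.I * u : ℂ) = (u : ℂ) * (((u⁻¹ : ℝ) : ℂ) + Complex.I) := by
      have : (u : ℂ) ≠ 0 := by exact_mod_cast hu.ne'
      push_cast
      field_simp
    have hne : ((u⁻¹ : ℝ) : ℂ) + Complex.I ≠ 0 := by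
      intro h
      have := congrArg Complex.im h
      simp at this
    rw [e, ofReal_mul_cpow hu hne, ← mul_assoc, ← Complex.ofReal_mul, ← Real.rpow_add hu]
    simp
  have hc : Continuous fun u : ℝ => ((u ^ (a + 1) : ℝ) : ℂ) *
      (1 + Complex.I * u : ℂ) ^ ((-(a + 1) : ℝ) : ℂ) / (a + 1) :=
    ((Complex.continuous_ofReal.comp (Real.continuous_rpow_const (by linarith))).mul
      (continuous_one_add_I_mul_cpow _)).div_const _
  have h := integral_Ioi_of_hasDerivAt_of_tendsto (a := 0) hc.continuousWithinAt
    (fun u hu => hd u hu) hi hl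
  rw [h, Real.zero_rpow (by linarith : a + 1 ≠ 0)]
  simp

/-- The weight is even, so the sine part vanishes. -/
theorem besselF_eq_integral_cexp {a : ℝ} (ha : 0 ≤ a) (t : ℝ) :
    (besselF a t : ℂ)
      = ∫ x in (-1 : ℝ)..1, (gegenbauer a x : ℂ) * Complex.exp (Complex.I * (t * x)) := by
  have hg := continuous_gegenbauer ha
  have hodd : sinTransform (gegenbauer a) t = 0 := by
    have h := intervalIntegral.integral_comp_neg (a := -1) (b := 1)
      (fun x => gegenbauer a x * Real.sin (t * x))
    have e : ∀ x, gegenbauer a (-x) = gegenbauer a x := fun x => by simp [gegenbauer]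
    simp only [e, mul_neg, Real.sin_neg, neg_neg, intervalIntegral.integral_neg] at h
    rw [sinTransform]
    linarith
  have h1 : ∀ x : ℝ, (gegenbauer a x : ℂ) * Complex.exp (Complex.I * (t * x))
      = ((gegenbauer a x * Real.cos (t * x) : ℝ) : ℂ)
        + Complex.I * ((gegenbauer a x * Real.sin (t * x) : ℝ) : ℂ) := by
    intro x
    rw [mul_comm Complex.I, Complex.exp_mul_I]
    push_cast
    ring
  simp only [h1]
  rw [intervalIntegral.integral_add (Continuous.intervalIntegrable (by fun_prop) _ _)
    (Continuous.intervalIntegrable (by fun_prop) _ _), intervalIntegral.integral_const_mul,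
    intervalIntegral.integral_ofReal, intervalIntegral.integral_ofReal]
  change _ = ((cosTransform (gegenbauer a) t : ℝ) : ℂ)
    + Complex.I * ((sinTransform (gegenbauer a) t : ℝ) : ℂ)
  rw [hodd]
  simp [besselF]

/-- The Laplace transform of `besselV` on the vertical line through `i`. -/
theorem laplace_besselV {a s : ℝ} (ha : 0 ≤ a) (hs : 0 < s) :
    ∫ t in Ioi (0 : ℝ), Complex.exp (-((s + Complex.I) * t)) * besselV a t
      = Real.Gamma (a + 2) * ∫ x in (-1 : ℝ)..1,
        (gegenbauer a x : ℂ) * (s + Complex.I * ((1 - x : ℝ) : ℂ)) ^ ((-(a + 2) : ℝ) : ℂ) := by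
  have hg := continuous_gegenbauer ha
  have h1 : ∀ t : ℝ, Complex.exp (-((s + Complex.I) * t)) * besselV a t
      = ∫ x in (-1 : ℝ)..1, (gegenbauer a x : ℂ) * (((t ^ (a + 1) : ℝ) : ℂ) *
        Complex.exp (-((s + Complex.I * ((1 - x : ℝ) : ℂ)) * t))) := by
    intro t
    rw [besselV, Complex.ofReal_mul, besselF_eq_integral_cexp ha,
      ← intervalIntegral.integral_const_mul, ← intervalIntegral.integral_const_mul]
    refine intervalIntegral.integral_congr fun x _ => ?_
    have : Complex.exp (-((s + Complex.I * ((1 - x : ℝ) : ℂ)) * t))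
        = Complex.exp (-((s + Complex.I) * t)) * Complex.exp (Complex.I * (t * x)) := by
      rw [← Complex.exp_add]
      congr 1
      push_cast
      ring
    simp only [this]
    ring
  simp only [h1]
  -- Fubini reduces the claim to `laplace_rpow` with imaginary part `1 - x`. It is justified by the
  -- majorant `t^(a+1) exp (-s t)`, which does not depend on `x`.
  rw [← intervalIntegral_integral_swap]
  · rw [← intervalIntegral.integral_const_mul]
    refine intervalIntegral.integral_congr fun x _ => ?_
    rw [integral_const_mul, laplace_rpow (by linarith) hs]
    have : a + 1 + 1 = a + 2 := by ring
    rw [this]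
    ring
  · have hb : Integrable (fun z : ℝ × ℝ => 1 * (z.2 ^ (a + 1) * Real.exp (-(s * z.2))))
        ((volume.restrict (uIoc (-1) 1)).prod (volume.restrict (Ioi 0))) :=
      Integrable.mul_prod (f := fun _ : ℝ => (1 : ℝ))
        (g := fun t : ℝ => t ^ (a + 1) * Real.exp (-(s * t)))
        (by simp [uIoc_of_le])
        (integrableOn_rpow_mul_exp_neg (by linarith) hs)
    refine Integrable.mono' hb ?_ ?_
    · have := hg.measurable
      unfold Function.uncurry
      exact (Measurable.aestronglyMeasurable (by fun_prop))
    · rw [Measure.prod_restrict]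
      refine (ae_restrict_iff' (measurableSet_uIoc.prod measurableSet_Ioi)).2
        (.of_forall fun z hz => ?_)
      obtain ⟨hx, ht⟩ := hz
      rw [uIoc_of_le (by norm_num)] at hx
      have hx' : z.1 ∈ Icc (-1 : ℝ) 1 := ⟨hx.1.le, hx.2⟩
      have ht' : 0 < z.2 := ht
      simp only [Function.uncurry]
      rw [norm_mul, norm_mul, norm_cexp_neg_mul, Complex.norm_real, Complex.norm_real,
        Real.norm_eq_abs, Real.norm_eq_abs, abs_of_nonneg (gegenbauer_nonneg hx'),
        abs_of_nonneg (Real.rpow_nonneg ht'.le _)]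
      have : (s + Complex.I * ((1 - z.1 : ℝ) : ℂ)).re = s := by simp
      rw [this]
      exact mul_le_mul_of_nonneg_right (gegenbauer_le_one ha hx') (by positivity)

/-- As `s → 0` the singularity sits at the endpoint `x = 1`. The substitution `x = 1 - s u` zooms in
on it: the weight contributes `s^a`, the kernel `s^(-(a+2))` and the differential `s`, and the
prefactor `s` balances them. -/
theorem laplace_besselV_rescaled {a s : ℝ} (ha : 0 ≤ a) (hs : 0 < s) :
    s * ∫ t in Ioi (0 : ℝ), Complex.exp (-((s + Complex.I) * t)) * besselV a t
      = Real.Gamma (a + 2) * ∫ u in (0 : ℝ)..(2 / s), (((u * (2 - s * u)) ^ a : ℝ) : ℂ) *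
        (1 + Complex.I * u : ℂ) ^ ((-(a + 2) : ℝ) : ℂ) := by
  have hs' : (s : ℂ) ≠ 0 := by exact_mod_cast hs.ne'
  rw [laplace_besselV ha hs]
  have h := intervalIntegral.integral_comp_sub_mul (a := 0) (b := 2 / s)
    (fun x : ℝ => (gegenbauer a x : ℂ) *
      (s + Complex.I * ((1 - x : ℝ) : ℂ)) ^ ((-(a + 2) : ℝ) : ℂ)) hs.ne' 1
  have e1 : 1 - s * (2 / s) = -1 := by field_simp; norm_num
  rw [e1, mul_zero, sub_zero] at h
  have h2 : ∫ u in (0 : ℝ)..(2 / s), (gegenbauer a (1 - s * u) : ℂ) *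
      (s + Complex.I * ((1 - (1 - s * u) : ℝ) : ℂ)) ^ ((-(a + 2) : ℝ) : ℂ)
      = ((s ^ (-2 : ℝ) : ℝ) : ℂ) * ∫ u in (0 : ℝ)..(2 / s), (((u * (2 - s * u)) ^ a : ℝ) : ℂ) *
        (1 + Complex.I * u : ℂ) ^ ((-(a + 2) : ℝ) : ℂ) := by
    rw [← intervalIntegral.integral_const_mul]
    refine intervalIntegral.integral_congr fun u hu => ?_
    rw [uIcc_of_le (by positivity)] at hu
    have hu2 : s * u ≤ 2 := by
      have := (le_div_iff₀ hs).1 hu.2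
      linarith
    have e2 : (s + Complex.I * ((1 - (1 - s * u) : ℝ) : ℂ)) = (s : ℂ) * (1 + Complex.I * u) := by
      push_cast; ring
    have e3 : gegenbauer a (1 - s * u) = s ^ a * (u * (2 - s * u)) ^ a := by
      rw [← Real.mul_rpow hs.le (mul_nonneg hu.1 (by linarith)), gegenbauer]
      congr 1
      ring
    have e4 : s ^ (-2 : ℝ) = s ^ a * s ^ (-(a + 2)) := by
      rw [← Real.rpow_add hs]; congr 1; ring
    rw [e2, ofReal_mul_cpow hs (one_add_I_mul_ne_zero u), e3, e4]
    push_cast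
    ring
  rw [h2, Complex.real_smul, Real.rpow_neg hs.le, Real.rpow_two] at h
  generalize (∫ u in (0 : ℝ)..(2 / s), (((u * (2 - s * u)) ^ a : ℝ) : ℂ) *
        (1 + Complex.I * u : ℂ) ^ ((-(a + 2) : ℝ) : ℂ)) = J at h ⊢
  generalize (∫ x in (-1 : ℝ)..1, (gegenbauer a x : ℂ) *
      (s + Complex.I * ((1 - x : ℝ) : ℂ)) ^ ((-(a + 2) : ℝ) : ℂ)) = K at h ⊢
  have h3 : J = s * K := by
    push_cast at h
    field_simp at h
    exact h
  rw [h3]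
  ring

/-- Dominated convergence on the half-line: `2 - s u` lies in `[0, 2]` on the domain of integration
and tends to `2` for fixed `u`. -/
theorem tendsto_rescaled_integral {a : ℝ} (ha : 0 ≤ a) :
    Tendsto (fun s : ℝ => ∫ u in (0 : ℝ)..(2 / s), (((u * (2 - s * u)) ^ a : ℝ) : ℂ) *
        (1 + Complex.I * u : ℂ) ^ ((-(a + 2) : ℝ) : ℂ)) (𝓝[>] 0)
      (𝓝 ((2 ^ a : ℝ) * (Complex.I ^ ((-(a + 1) : ℝ) : ℂ) / (a + 1)))) := by
  rw [← integral_rpow_mul_one_add_I ha, ← integral_const_mul]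
  have h1 : ∀ᶠ s : ℝ in 𝓝[>] 0, ∫ u in Ioi (0 : ℝ), (Iic (2 / s)).indicator (fun u : ℝ =>
      (((u * (2 - s * u)) ^ a : ℝ) : ℂ) * (1 + Complex.I * u : ℂ) ^ ((-(a + 2) : ℝ) : ℂ)) u
      = ∫ u in (0 : ℝ)..(2 / s), (((u * (2 - s * u)) ^ a : ℝ) : ℂ) *
        (1 + Complex.I * u : ℂ) ^ ((-(a + 2) : ℝ) : ℂ) := by
    filter_upwards [self_mem_nhdsWithin] with s (hs : 0 < s)
    rw [intervalIntegral.integral_of_le (by positivity), setIntegral_indicator measurableSet_Iic,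
      Ioi_inter_Iic]
  refine Tendsto.congr' h1 ?_
  have hm := (continuous_one_add_I_mul_cpow (-(a + 2))).measurable
  refine tendsto_integral_filter_of_dominated_convergence
    (fun u => 2 ^ a * (u ^ a * ‖(1 + Complex.I * u : ℂ)‖ ^ (-(a + 2))))
    (.of_forall fun s => ?_) ?_ ((integrableOn_rpow_mul_one_add_I ha).const_mul _) ?_
  · refine (Measurable.indicator ?_ measurableSet_Iic).aestronglyMeasurable
    fun_prop
  · filter_upwards [self_mem_nhdsWithin] with s (hs : 0 < s)
    refine (ae_restrict_iff' measurableSet_Ioi).2 (.of_forall fun u (hu : 0 < u) => ?_)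
    by_cases h : u ∈ Iic (2 / s)
    · have hu2 : s * u ≤ 2 := by
        have := (le_div_iff₀ hs).1 (mem_Iic.1 h)
        linarith
      have hsu : 0 < s * u := mul_pos hs hu
      rw [indicator_of_mem h, norm_mul, Complex.norm_real, Complex.norm_cpow_real,
        Real.norm_eq_abs, abs_of_nonneg (Real.rpow_nonneg (mul_nonneg hu.le (by linarith)) _),
        ← mul_assoc, ← Real.mul_rpow (by norm_num) hu.le]
      gcongr ?_ * _
      exact Real.rpow_le_rpow (mul_nonneg hu.le (by linarith)) (by nlinarith) ha
    · rw [indicator_of_notMem h, norm_zero]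
      positivity
  · refine (ae_restrict_iff' measurableSet_Ioi).2 (.of_forall fun u (hu : 0 < u) => ?_)
    have h2 : Tendsto (fun s : ℝ => (((u * (2 - s * u)) ^ a : ℝ) : ℂ) *
        (1 + Complex.I * u : ℂ) ^ ((-(a + 2) : ℝ) : ℂ)) (𝓝[>] 0)
        (𝓝 ((2 ^ a : ℝ) * (((u ^ a : ℝ) : ℂ) *
          (1 + Complex.I * u : ℂ) ^ ((-(a + 2) : ℝ) : ℂ)))) := by
      have hc : Continuous fun s : ℝ => (((u * (2 - s * u)) ^ a : ℝ) : ℂ) *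
          (1 + Complex.I * u : ℂ) ^ ((-(a + 2) : ℝ) : ℂ) := by
        refine (Complex.continuous_ofReal.comp ?_).mul continuous_const
        exact Continuous.rpow_const (by fun_prop) fun _ => Or.inr ha
      have := (hc.tendsto 0).mono_left (nhdsWithin_le_nhds (s := Ioi 0))
      rw [zero_mul, sub_zero, mul_comm u, Real.mul_rpow (by norm_num) hu.le] at this
      rw [← mul_assoc, ← Complex.ofReal_mul]
      exact this
    refine h2.congr' ?_
    have h3 : ∀ᶠ s : ℝ in 𝓝[>] 0, s < 2 / u := by
      exact nhdsWithin_le_nhds (Iio_mem_nhds (by positivity))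
    filter_upwards [self_mem_nhdsWithin, h3] with s (hs : 0 < s) hs2
    rw [indicator_of_mem]
    rw [mem_Iic, le_div_iff₀ hs]
    have := (lt_div_iff₀ hu).1 hs2
    linarith

/-- Demodulation moves the Laplace variable from `s` to `s + i`. Integration by parts, with `v(0) =
0`, replaces `v'` by `(s + i) v`, and the term `i v` supplies the second `i`. -/
theorem laplace_besselW {a s : ℝ} (ha : 0 ≤ a) (hs : 0 < s) :
    ∫ t in Ioi (0 : ℝ), Complex.exp (-(s * t)) * besselW a t
      = (s + 2 * Complex.I) *
        ∫ t in Ioi (0 : ℝ), Complex.exp (-((s + Complex.I) * t)) * besselV a t := by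
  obtain ⟨C, hC0, hC⟩ := exists_abs_besselV_le ha
  have hv := (continuous_besselV ha)
  have hv' := (continuous_besselV' ha)
  have hre : (s + Complex.I : ℂ).re = s := by simp
  have hexp : IntegrableOn (fun t : ℝ => Real.exp (-(s * t)) * C) (Ioi 0) := by
    have := (exp_neg_integrableOn_Ioi 0 hs).mul_const C
    simp only [neg_mul] at this
    exact this
  have hi : ∀ f : ℝ → ℝ, Continuous f → (∀ t, 0 ≤ t → |f t| ≤ C) →
      IntegrableOn (fun t : ℝ => Complex.exp (-((s + Complex.I) * t)) * f t) (Ioi 0) := by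
    intro f hf hfC
    refine Integrable.mono' hexp (Continuous.aestronglyMeasurable (by fun_prop)) ?_
    refine (ae_restrict_iff' measurableSet_Ioi).2 (.of_forall fun t (ht : 0 < t) => ?_)
    rw [norm_mul, norm_cexp_neg_mul, hre, Complex.norm_real]
    exact mul_le_mul_of_nonneg_left (hfC t ht.le) (Real.exp_pos _).le
  have i1 := hi _ hv fun t ht => (hC t ht).1
  have i2 := hi _ hv' fun t ht => (hC t ht).2.1
  have hd : ∀ t : ℝ, HasDerivAt (fun t : ℝ => Complex.exp (-((s + Complex.I) * t)) * besselV a t)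
      (Complex.exp (-((s + Complex.I) * t)) * besselV' a t
        - (s + Complex.I) * (Complex.exp (-((s + Complex.I) * t)) * besselV a t)) t := by
    intro t
    refine HasDerivAt.congr_deriv ((hasDerivAt_cexp_neg_mul (s + Complex.I) t).mul
      (hasDerivAt_besselV (t := t) ha).ofReal_comp) ?_
    ring
  have hl : Tendsto (fun t : ℝ => Complex.exp (-((s + Complex.I) * t)) * besselV a t) atTop
      (𝓝 0) := by
    have h0 : Tendsto (fun t : ℝ => Real.exp (-(s * t)) * C) atTop (𝓝 0) := by
      have := (Real.tendsto_exp_neg_atTop_nhds_zero.comp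
        (tendsto_id.const_mul_atTop hs)).mul_const C
      simpa using this
    refine squeeze_zero_norm' ?_ h0
    filter_upwards [eventually_ge_atTop 0] with t ht
    rw [norm_mul, norm_cexp_neg_mul, hre, Complex.norm_real]
    exact mul_le_mul_of_nonneg_left (hC t ht).1 (Real.exp_pos _).le
  have h := integral_Ioi_of_hasDerivAt_of_tendsto' (a := 0) (fun t _ => hd t)
    (i2.sub (i1.const_mul _)) hl
  rw [integral_sub i2 (i1.const_mul _), integral_const_mul, besselV_zero ha] at h
  simp only [Complex.ofReal_zero, mul_zero, sub_zero] at h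
  have h1 : ∀ t : ℝ, Complex.exp (-(s * t)) * besselW a t
      = Complex.exp (-((s + Complex.I) * t)) * besselV' a t
        + Complex.I * (Complex.exp (-((s + Complex.I) * t)) * besselV a t) := by
    intro t
    have : Complex.exp (-((s + Complex.I) * t))
        = Complex.exp (-(s * t)) * Complex.exp (-(Complex.I * t)) := by
      rw [← Complex.exp_add]; congr 1; ring
    rw [besselW, this]
    ring
  simp only [h1]
  rw [integral_add i2 (i1.const_mul _), integral_const_mul]
  linear_combination h

/-- The asymptotic amplitude of the normalised Bessel function. -/
theorem norm_limit_besselW {a : ℝ} (ha : 0 ≤ a) {W : ℂ} (hW : Tendsto (besselW a) atTop (𝓝 W)) :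
    ‖W‖ = 2 ^ (a + 1) * Real.Gamma (a + 1) := by
  obtain ⟨C, hC0, hC⟩ := exists_besselE_le ha
  have hb : ∀ t, 0 < t → ‖besselW a t‖ ≤ C + 1 := by
    intro t ht
    have h1 := hC t ht.le
    rw [← norm_besselW_sq] at h1
    nlinarith [norm_nonneg (besselW a t)]
  have h1 := tendsto_mul_laplace (continuous_besselW ha).measurable hb hW
  have h2 : Tendsto (fun s : ℝ => ((s : ℂ) + 2 * Complex.I) * (Real.Gamma (a + 2) *
      ∫ u in (0 : ℝ)..(2 / s), (((u * (2 - s * u)) ^ a : ℝ) : ℂ) *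
        (1 + Complex.I * u : ℂ) ^ ((-(a + 2) : ℝ) : ℂ))) (𝓝[>] 0)
      (𝓝 ((((0 : ℝ) : ℂ) + 2 * Complex.I) * (Real.Gamma (a + 2) *
        ((2 ^ a : ℝ) * (Complex.I ^ ((-(a + 1) : ℝ) : ℂ) / (a + 1)))))) := by
    refine Tendsto.mul ?_ ((tendsto_rescaled_integral ha).const_mul _)
    have : Continuous fun s : ℝ => (s : ℂ) + 2 * Complex.I := by fun_prop
    exact (this.tendsto 0).mono_left nhdsWithin_le_nhds
  -- The Abel limit and the explicit limit of the same Laplace transform must agree. Only the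
  -- modulus is needed afterwards, so the phase `I ^ (-(a + 1))` drops out.
  have h3 : W = (((0 : ℝ) : ℂ) + 2 * Complex.I) * (Real.Gamma (a + 2) *
        ((2 ^ a : ℝ) * (Complex.I ^ ((-(a + 1) : ℝ) : ℂ) / (a + 1)))) := by
    refine tendsto_nhds_unique h1 (h2.congr' ?_)
    filter_upwards [self_mem_nhdsWithin] with s (hs : 0 < s)
    rw [laplace_besselW ha hs, ← laplace_besselV_rescaled ha hs]
    ring
  have ha1 : 0 < a + 1 := by linarith
  have e1 : ‖((a : ℂ) + 1)‖ = a + 1 := by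
    have : ((a : ℂ) + 1) = ((a + 1 : ℝ) : ℂ) := by push_cast; rfl
    rw [this, Complex.norm_real, Real.norm_eq_abs, abs_of_pos ha1]
  have e2 : Real.Gamma (a + 2) = (a + 1) * Real.Gamma (a + 1) := by
    rw [← Real.Gamma_add_one ha1.ne']; congr 1; ring
  rw [h3, Complex.ofReal_zero, zero_add, norm_mul, norm_mul, norm_mul, norm_mul, norm_div,
    Complex.norm_cpow_real, Complex.norm_I, Real.one_rpow, e1, Complex.norm_real,
    Complex.norm_real, Real.norm_eq_abs, Real.norm_eq_abs,
    abs_of_pos (Real.Gamma_pos_of_pos (by linarith : 0 < a + 2)),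
    abs_of_pos (by positivity : (0 : ℝ) < 2 ^ a), e2,
    Real.rpow_add_one (by norm_num)]
  norm_num
  field_simp

/-- The mean square of the normalised Bessel function. -/
theorem tendsto_mean_besselV_sq {a : ℝ} (ha : 0 ≤ a) :
    Tendsto (fun T : ℝ => 1 / T * ∫ t in (0 : ℝ)..T, besselV a t ^ 2) atTop
      (𝓝 ((2 ^ (a + 1) * Real.Gamma (a + 1)) ^ 2 / 2)) := by
  obtain ⟨W, hW⟩ := exists_tendsto_besselW ha
  rw [← norm_limit_besselW ha hW]
  exact tendsto_cesaro_besselV_sq ha hW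

/-! ### Fourier transform of the indicator of a ball. -/

open Set Metric

/-- The volume of the section of the unit ball of `ℝ^{m+1}` at first coordinate `x`. -/
theorem volume_real_section {m : ℕ} {x : ℝ} (hx : x ∈ Ioo (-1 : ℝ) 1) :
    (volume : Measure (Fin m → ℝ)).real {y | x ^ 2 + ∑ i, y i ^ 2 < 1}
      = volume.real (ball (0 : EuclideanSpace ℝ (Fin m)) 1) * gegenbauer ((m : ℝ) / 2) x := by
  have hx2 : 0 < 1 - x ^ 2 := by nlinarith [hx.1, hx.2]
  have h1 : {y : Fin m → ℝ | x ^ 2 + ∑ i, y i ^ 2 < 1}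
      = WithLp.toLp 2 ⁻¹' ball (0 : EuclideanSpace ℝ (Fin m)) (√(1 - x ^ 2)) := by
    ext y
    rw [mem_preimage, EuclideanSpace.ball_zero_eq _ (Real.sqrt_nonneg _), Real.sq_sqrt hx2.le]
    simp only [mem_ofPred_eq]
    constructor <;> intro h <;> linarith
  rw [h1, measureReal_def, (PiLp.volume_preserving_toLp (Fin m)).measure_preimage
    measurableSet_ball.nullMeasurableSet, Measure.addHaar_ball_of_pos _ _ (Real.sqrt_pos.2 hx2),
    ENNReal.toReal_mul, ENNReal.toReal_ofReal (by positivity), mul_comm, measureReal_def,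
    finrank_euclideanSpace, Fintype.card_fin, gegenbauer, Real.sqrt_eq_rpow, ← Real.rpow_natCast,
    ← Real.rpow_mul hx2.le]
  congr 2
  ring

/-- Slicing the unit ball of `ℝ^{m+1}` along the first coordinate. -/
theorem integral_ball_cexp_first_coord (m : ℕ) (t : ℝ) :
    ∫ x in ball (0 : EuclideanSpace ℝ (Fin (m + 1))) 1, Complex.exp (-Complex.I * (x 0 * t : ℝ))
      = (volume.real (ball (0 : EuclideanSpace ℝ (Fin m)) 1) * besselF ((m : ℝ) / 2) t : ℝ) := by
  set S : Set (ℝ × (Fin m → ℝ)) := {p | p.1 ^ 2 + ∑ i, p.2 i ^ 2 < 1} with hS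
  have hSm : MeasurableSet S := by
    refine measurableSet_lt ?_ measurable_const
    fun_prop
  set e := (MeasurableEquiv.piFinSuccAbove (fun _ : Fin (m + 1) => ℝ) 0).symm.trans
    (MeasurableEquiv.toLp 2 (Fin (m + 1) → ℝ)) with he
  have hmp : MeasurePreserving e :=
    (PiLp.volume_preserving_toLp (Fin (m + 1))).comp
      (volume_preserving_piFinSuccAbove (fun _ : Fin (m + 1) => ℝ) 0).symm
  have he0 : ∀ p, (e p) 0 = p.1 := fun p => rfl
  have heS : e ⁻¹' ball (0 : EuclideanSpace ℝ (Fin (m + 1))) 1 = S := by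
    ext p
    rw [mem_preimage, EuclideanSpace.ball_zero_eq _ zero_le_one, mem_ofPred_eq, Fin.sum_univ_succ,
      one_pow]
    rfl
  have hSfin : volume S < ⊤ := by
    rw [← heS, hmp.measure_preimage measurableSet_ball.nullMeasurableSet]
    exact measure_ball_lt_top
  rw [← hmp.setIntegral_preimage_emb e.measurableEmbedding, heS]
  simp only [he0]
  rw [← integral_indicator hSm, Measure.volume_eq_prod, integral_prod]
  · have h1 : ∀ x : ℝ, ∫ y : Fin m → ℝ, S.indicator
        (fun p => Complex.exp (-Complex.I * (p.1 * t : ℝ))) (x, y)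
        = (Ioo (-1 : ℝ) 1).indicator (fun x => Complex.exp (-Complex.I * (x * t : ℝ)) *
          (volume.real (ball (0 : EuclideanSpace ℝ (Fin m)) 1) * gegenbauer ((m : ℝ) / 2) x : ℝ))
            x := by
      intro x
      have h2 : ∀ y : Fin m → ℝ, S.indicator
          (fun p => Complex.exp (-Complex.I * (p.1 * t : ℝ))) (x, y)
          = {y : Fin m → ℝ | x ^ 2 + ∑ i, y i ^ 2 < 1}.indicator
            (fun _ => Complex.exp (-Complex.I * (x * t : ℝ))) y := fun y => rfl
      simp only [h2]
      rw [integral_indicator (measurableSet_lt (by fun_prop) measurable_const), setIntegral_const,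
        Complex.real_smul, mul_comm]
      by_cases hx : x ∈ Ioo (-1 : ℝ) 1
      · rw [indicator_of_mem hx, volume_real_section hx]
      · rw [indicator_of_notMem hx]
        have : {y : Fin m → ℝ | x ^ 2 + ∑ i, y i ^ 2 < 1} = ∅ := by
          refine eq_empty_of_forall_notMem fun y hy => hx ?_
          have h3 : 0 ≤ ∑ i, y i ^ 2 := Finset.sum_nonneg fun i _ => sq_nonneg _
          have h4 : x ^ 2 + ∑ i, y i ^ 2 < 1 := hy
          exact abs_lt.1 ((sq_lt_one_iff_abs_lt_one x).1 (by linarith))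
        rw [this]
        simp
    simp only [h1]
    rw [integral_indicator measurableSet_Ioo, ← integral_Ioc_eq_integral_Ioo,
      ← intervalIntegral.integral_of_le (by norm_num), Complex.ofReal_mul,
      besselF_eq_integral_cexp (by positivity), ← intervalIntegral.integral_const_mul]
    -- Reflecting `x` reconciles the sign of the exponential with `besselF_eq_integral_cexp`.
    have h3 := intervalIntegral.integral_comp_neg (a := -1) (b := 1) (fun x : ℝ =>
      (volume.real (ball (0 : EuclideanSpace ℝ (Fin m)) 1) : ℂ) *
        ((gegenbauer ((m : ℝ) / 2) x : ℂ) * Complex.exp (Complex.I * (t * x))))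
    rw [neg_neg] at h3
    rw [← h3]
    refine intervalIntegral.integral_congr fun x _ => ?_
    have e1 : gegenbauer ((m : ℝ) / 2) (-x) = gegenbauer ((m : ℝ) / 2) x := by simp [gegenbauer]
    have e2 : Complex.I * ((t : ℂ) * ((-x : ℝ) : ℂ)) = -Complex.I * ((x * t : ℝ) : ℂ) := by
      push_cast; ring
    simp only [e1, e2]
    push_cast
    ring
  · rw [integrable_indicator_iff hSm]
    refine Measure.integrableOn_of_bounded (M := 1) hSfin.ne
      (Measurable.aestronglyMeasurable (by fun_prop)) (.of_forall fun p => ?_)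
    rw [Complex.norm_exp]
    simp

/-- The Fourier transform of the indicator function of the centered ball of radius `r`. -/
def ballHat {n : ℕ} (r : ℝ) (ξ : EuclideanSpace ℝ (Fin n)) : ℂ :=
  ∫ x in ball (0 : EuclideanSpace ℝ (Fin n)) r, Complex.exp (-Complex.I * (inner ℝ x ξ : ℝ))

/-- Two vectors of equal norm are exchanged by the reflection in the hyperplane orthogonal to their
difference. This reduces `ballHat` to frequencies along the first axis. -/
theorem exists_linearIsometryEquiv_apply_eq {m : ℕ} (ξ : EuclideanSpace ℝ (Fin (m + 1))) :
    ∃ ρ : EuclideanSpace ℝ (Fin (m + 1)) ≃ₗᵢ[ℝ] EuclideanSpace ℝ (Fin (m + 1)),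
      ρ ξ = EuclideanSpace.single 0 ‖ξ‖ := by
  refine ⟨(Submodule.span ℝ {ξ - EuclideanSpace.single 0 ‖ξ‖})ᗮ.reflection, ?_⟩
  exact Submodule.reflection_sub (by simp)

theorem ballHat_one {m : ℕ} (ξ : EuclideanSpace ℝ (Fin (m + 1))) :
    ballHat 1 ξ
      = (volume.real (ball (0 : EuclideanSpace ℝ (Fin m)) 1) * besselF ((m : ℝ) / 2) ‖ξ‖ : ℝ) := by
  obtain ⟨ρ, hρ⟩ := exists_linearIsometryEquiv_apply_eq ξ
  rw [← integral_ball_cexp_first_coord, ← ρ.measurePreserving.setIntegral_preimage_emb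
    ρ.toHomeomorph.measurableEmbedding, ballHat]
  have h1 : ρ ⁻¹' ball 0 1 = ball 0 1 := by
    rw [ρ.preimage_ball, map_zero]
  rw [h1]
  refine integral_congr_ae (.of_forall fun x => ?_)
  have : inner ℝ x ξ = (ρ x) 0 * ‖ξ‖ := by
    rw [← ρ.inner_map_map, hρ, EuclideanSpace.inner_single_right]
    simp [mul_comm]
  simp only [this]

theorem ballHat_eq {m : ℕ} {r : ℝ} (hr : 0 < r) (ξ : EuclideanSpace ℝ (Fin (m + 1))) :
    ballHat r ξ = (r ^ (m + 1) *
      (volume.real (ball (0 : EuclideanSpace ℝ (Fin m)) 1) *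
        besselF ((m : ℝ) / 2) (r * ‖ξ‖)) : ℝ) := by
  have h := Measure.setIntegral_comp_smul_of_pos volume
    (fun x : EuclideanSpace ℝ (Fin (m + 1)) => Complex.exp (-Complex.I * (inner ℝ x ξ : ℝ)))
    (ball 0 1) hr
  have h1 := ballHat_one (r • ξ)
  rw [norm_smul, Real.norm_eq_abs, abs_of_pos hr] at h1
  rw [smul_unitBall_of_pos hr, finrank_euclideanSpace, Fintype.card_fin] at h
  have h2 : ballHat 1 (r • ξ) = ∫ x in ball (0 : EuclideanSpace ℝ (Fin (m + 1))) 1,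
      Complex.exp (-Complex.I * (inner ℝ (r • x) ξ : ℝ)) := by
    rw [ballHat]
    simp only [real_inner_smul_left, real_inner_smul_right]
  rw [h2, h] at h1
  change (r ^ (m + 1))⁻¹ • ballHat r ξ = _ at h1
  rw [Complex.ofReal_mul, ← h1, Complex.real_smul, ← mul_assoc, ← Complex.ofReal_mul,
    mul_inv_cancel₀ (by positivity), Complex.ofReal_one, one_mul]

/-- The profile of the number variance of a plane wave, `ω_m² v(t)²`. -/
def waveProfile (m : ℕ) (t : ℝ) : ℝ :=
  (volume.real (ball (0 : EuclideanSpace ℝ (Fin m)) 1) * besselV ((m : ℝ) / 2) t) ^ 2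

/-- Of the `r^(2m+2)` coming from scaling, `v(r‖ξ‖)²` absorbs `(r‖ξ‖)^(m+2)`. What is left is the
surface growth `r^m` and the spectral weight `‖ξ‖^(-(m+2))`. -/
theorem norm_ballHat_sq {m : ℕ} {r : ℝ} (hr : 0 < r) {ξ : EuclideanSpace ℝ (Fin (m + 1))}
    (hξ : ξ ≠ 0) :
    ‖ballHat r ξ‖ ^ 2 = r ^ m * (waveProfile m (r * ‖ξ‖) * (1 / ‖ξ‖ ^ (m + 2))) := by
  have hξ0 : 0 < ‖ξ‖ := norm_pos_iff.2 hξ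
  have ht : 0 < r * ‖ξ‖ := by positivity
  have h1 : ((r * ‖ξ‖) ^ ((m : ℝ) / 2 + 1)) ^ 2 = r ^ (m + 2) * ‖ξ‖ ^ (m + 2) := by
    rw [← Real.rpow_natCast, ← Real.rpow_mul ht.le, ← mul_pow, ← Real.rpow_natCast _ (m + 2)]
    congr 1
    push_cast
    ring
  rw [ballHat_eq hr, Complex.norm_real, Real.norm_eq_abs, sq_abs, waveProfile, besselV]
  simp only [mul_pow _ (besselF _ _), mul_pow (volume.real _), h1, mul_pow (r ^ (m + 1))]
  field_simp
  ring

theorem waveProfile_nonneg (m : ℕ) (t : ℝ) : 0 ≤ waveProfile m t := sq_nonneg _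

theorem continuous_waveProfile (m : ℕ) : Continuous (waveProfile m) :=
  (continuous_const.mul (continuous_besselV (by positivity))).pow 2

theorem exists_waveProfile_le (m : ℕ) : ∃ C, 0 < C ∧ ∀ t, 0 ≤ t → waveProfile m t ≤ C := by
  obtain ⟨C, hC0, hC⟩ := exists_abs_besselV_le (a := (m : ℝ) / 2) (by positivity)
  refine ⟨(volume.real (ball (0 : EuclideanSpace ℝ (Fin m)) 1)) ^ 2 * C ^ 2 + 1, by positivity,
    fun t ht => ?_⟩
  have h := pow_le_pow_left₀ (abs_nonneg _) (hC t ht).1 2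
  rw [sq_abs] at h
  rw [waveProfile, mul_pow]
  have := mul_le_mul_of_nonneg_left h
    (sq_nonneg (volume.real (ball (0 : EuclideanSpace ℝ (Fin m)) 1)))
  linarith

theorem volume_real_unit_ball (m : ℕ) :
    volume.real (ball (0 : EuclideanSpace ℝ (Fin m)) 1)
      = √Real.pi ^ m / Real.Gamma ((m : ℝ) / 2 + 1) := by
  -- The case `m = 0` is the one needed for random measures on the line: the ball is a point of mass
  -- one.
  rcases Nat.eq_zero_or_pos m with rfl | hm
  · have : ball (0 : EuclideanSpace ℝ (Fin 0)) 1 = univ := by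
      ext x
      simp [Subsingleton.elim x 0]
    rw [this, measureReal_def, ← (PiLp.volume_preserving_toLp (Fin 0)).measure_preimage
      MeasurableSet.univ.nullMeasurableSet, preimage_univ, volume_pi, Measure.pi_univ]
    simp
  · have : Nonempty (Fin m) := ⟨⟨0, hm⟩⟩
    rw [measureReal_def, EuclideanSpace.volume_ball]
    have : 0 < Real.Gamma ((m : ℝ) / 2 + 1) := Real.Gamma_pos_of_pos (by positivity)
    simp only [ENNReal.ofReal_one, one_pow, one_mul, Fintype.card_fin]
    rw [ENNReal.toReal_ofReal (by positivity)]

/-- The Gamma factor in the amplitude cancels the one in the volume of the unit ball of `ℝ^m`. -/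
theorem tendsto_mean_waveProfile (m : ℕ) :
    Tendsto (fun T : ℝ => 1 / T * ∫ t in (0 : ℝ)..T, waveProfile m t) atTop
      (𝓝 (2 ^ (m + 1) * Real.pi ^ m)) := by
  have h := (tendsto_mean_besselV_sq (a := (m : ℝ) / 2) (by positivity)).const_mul
    ((volume.real (ball (0 : EuclideanSpace ℝ (Fin m)) 1)) ^ 2)
  have hc : (volume.real (ball (0 : EuclideanSpace ℝ (Fin m)) 1)) ^ 2 *
      ((2 ^ ((m : ℝ) / 2 + 1) * Real.Gamma ((m : ℝ) / 2 + 1)) ^ 2 / 2)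
      = 2 ^ (m + 1) * Real.pi ^ m := by
    have hG : 0 < Real.Gamma ((m : ℝ) / 2 + 1) := Real.Gamma_pos_of_pos (by positivity)
    have h2 : ((2 : ℝ) ^ ((m : ℝ) / 2 + 1)) ^ 2 = 2 ^ (m + 2) := by
      rw [← Real.rpow_natCast, ← Real.rpow_mul (by norm_num), ← Real.rpow_natCast _ (m + 2)]
      congr 1
      push_cast
      ring
    have h3 : (√Real.pi ^ m) ^ 2 = Real.pi ^ m := by
      rw [← pow_mul, mul_comm, pow_mul, Real.sq_sqrt Real.pi_pos.le]
    rw [volume_real_unit_ball, div_pow, h3, mul_pow, h2]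
    field_simp
    ring
  rw [hc] at h
  refine h.congr fun T => ?_
  simp only [waveProfile, mul_pow]
  rw [intervalIntegral.integral_const_mul]
  ring

/-! ### First and second moment measures of a random measure. -/

open Set Metric ProbabilityTheory

/-- Euclidean space of dimension `n`. -/
abbrev Eucl (n : ℕ) : Type := EuclideanSpace ℝ (Fin n)

instance isLocallyFiniteMeasure_coe {n : ℕ} (p : LFMeasure n) : IsLocallyFiniteMeasure p.1 := p.2

theorem measurable_eval {n : ℕ} {B : Set (Eucl n)} (hB : MeasurableSet B) :
    Measurable fun p : LFMeasure n => p.1 B :=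
  (Measure.measurable_coe hB).comp measurable_subtype_coe

/-- The π-system criterion is applied to finite measures. The products are therefore restricted to
balls, and the general case is a countable supremum. -/
theorem measurable_prod_self (n : ℕ) : Measurable fun p : LFMeasure n => p.1.prod p.1 := by
  have hfin : ∀ k : ℕ, Measurable fun p : LFMeasure n =>
      (p.1.restrict (ball 0 k)).prod (p.1.restrict (ball 0 k)) := by
    intro k
    have : ∀ p : LFMeasure n, IsFiniteMeasure (p.1.restrict (ball 0 k)) := fun p =>
      ⟨by rw [Measure.restrict_apply_univ]; exact measure_ball_lt_top⟩
    refine Measurable.measure_of_isPiSystem generateFrom_prod.symm isPiSystem_prod ?_ ?_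
    · rintro _ ⟨s, hs, t, ht, rfl⟩
      simp only [Measure.prod_prod]
      rw [mem_ofPred_eq] at hs ht
      simp only [Measure.restrict_apply hs, Measure.restrict_apply ht]
      exact (measurable_eval (hs.inter measurableSet_ball)).mul
        (measurable_eval (ht.inter measurableSet_ball))
    · simp only [← univ_prod_univ, Measure.prod_prod, Measure.restrict_apply_univ]
      exact (measurable_eval measurableSet_ball).mul (measurable_eval measurableSet_ball)
  refine Measure.measurable_of_measurable_coe _ fun S hS => ?_
  have h : ∀ p : LFMeasure n, p.1.prod p.1 S
      = ⨆ k : ℕ, (p.1.restrict (ball 0 k)).prod (p.1.restrict (ball 0 k)) S := by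
    intro p
    simp only [Measure.prod_restrict, Measure.restrict_apply hS]
    rw [← Monotone.measure_iUnion]
    · rw [← inter_iUnion]
      have : (⋃ k : ℕ, ball (0 : Eucl n) k ×ˢ ball (0 : Eucl n) k) = univ := by
        refine eq_univ_of_forall fun z => mem_iUnion.2 ?_
        obtain ⟨k, hk⟩ := exists_nat_gt (max ‖z.1‖ ‖z.2‖)
        exact ⟨k, by simpa using (le_max_left _ _).trans_lt hk,
          by simpa using (le_max_right _ _).trans_lt hk⟩
      rw [this, inter_univ]
    · intro i j hij
      have : (i : ℝ) ≤ j := by exact_mod_cast hij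
      exact inter_subset_inter_right _ (prod_mono (ball_subset_ball this) (ball_subset_ball this))
  simp only [h]
  exact Measurable.iSup fun k => (Measure.measurable_coe hS).comp (hfin k)

/-- The tautological kernel `p ↦ p`. -/
def pointKernel (n : ℕ) : Kernel (LFMeasure n) (Eucl n) := ⟨fun p => p.1, measurable_subtype_coe⟩

/-- The kernel `p ↦ p ⊗ p`. -/
def pairKernel (n : ℕ) : Kernel (LFMeasure n) (Eucl n × Eucl n) :=
  ⟨fun p => p.1.prod p.1, measurable_prod_self n⟩

/-- The mean measure of a random measure. -/
def meanMeasure {n : ℕ} (μ : Measure (LFMeasure n)) : Measure (Eucl n) := μ.bind (pointKernel n)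

/-- The second moment measure of a random measure. -/
def pairMeasure {n : ℕ} (μ : Measure (LFMeasure n)) : Measure (Eucl n × Eucl n) :=
  μ.bind (pairKernel n)

section bind

variable {α β F : Type*} [MeasurableSpace α] [MeasurableSpace β] [NormedAddCommGroup F]
  [NormedSpace ℝ F]

/-- The measure `μ` is viewed as a constant kernel on `Unit`, so that the statement becomes the
integral formula for a composition of kernels. -/
theorem integral_bind_kernel {μ : Measure α} {κ : Kernel α β} {f : β → F}
    (hf : Integrable f (μ.bind κ)) : ∫ y, f y ∂μ.bind κ = ∫ a, ∫ y, f y ∂κ a ∂μ := by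
  have h := Kernel.integral_comp (κ := Kernel.const Unit μ) (η := κ) (a := ()) (f := f)
    (by simpa [Kernel.comp_apply] using hf)
  simpa [Kernel.comp_apply] using h

theorem integrable_integral_bind_kernel {μ : Measure α} {κ : Kernel α β} {f : β → F}
    (hf : Integrable f (μ.bind κ)) : Integrable (fun a => ∫ y, f y ∂κ a) μ := by
  have h := Integrable.integral_comp (κ := Kernel.const Unit μ) (η := κ) (a := ()) (f := f)
    (by simpa [Kernel.comp_apply] using hf)
  simpa [Kernel.comp_apply] using h

end bind

theorem meanMeasure_apply {n : ℕ} (μ : Measure (LFMeasure n)) {B : Set (Eucl n)}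
    (hB : MeasurableSet B) : meanMeasure μ B = ∫⁻ p, p.1 B ∂μ :=
  Measure.bind_apply hB (pointKernel n).measurable.aemeasurable

theorem pairMeasure_apply {n : ℕ} (μ : Measure (LFMeasure n)) {S : Set (Eucl n × Eucl n)}
    (hS : MeasurableSet S) : pairMeasure μ S = ∫⁻ p, p.1.prod p.1 S ∂μ :=
  Measure.bind_apply hS (pairKernel n).measurable.aemeasurable

theorem lintegral_eval_lt_top {n : ℕ} {μ : Measure (LFMeasure n)} [IsProbabilityMeasure μ]
    (hsq : IsLocallySquareIntegrable μ) {B : Set (Eucl n)} (hB : MeasurableSet B)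
    (hB' : Bornology.IsBounded B) : ∫⁻ p, p.1 B ∂μ < ⊤ := by
  have h : ∫⁻ p, p.1 B ∂μ ≤ ∫⁻ p, (1 + p.1 B ^ 2) ∂μ := by
    refine lintegral_mono fun p => ?_
    rcases le_total (p.1 B) 1 with h | h
    · exact h.trans (le_add_of_nonneg_right (zero_le))
    · calc p.1 B = p.1 B * 1 := (mul_one _).symm
        _ ≤ p.1 B * p.1 B := by gcongr
        _ = p.1 B ^ 2 := (sq _).symm
        _ ≤ _ := le_add_of_nonneg_left (zero_le)
  refine h.trans_lt ?_
  rw [lintegral_add_left measurable_const, lintegral_one, measure_univ]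
  exact ENNReal.add_lt_top.2 ⟨ENNReal.one_lt_top, hsq B hB hB'⟩

theorem isFiniteMeasureOnCompacts_meanMeasure {n : ℕ} {μ : Measure (LFMeasure n)}
    [IsProbabilityMeasure μ] (hsq : IsLocallySquareIntegrable μ) :
    IsFiniteMeasureOnCompacts (meanMeasure μ) := by
  refine ⟨fun K hK => ?_⟩
  rw [meanMeasure_apply μ hK.isClosed.measurableSet]
  exact lintegral_eval_lt_top hsq hK.isClosed.measurableSet hK.isBounded

theorem isFiniteMeasureOnCompacts_pairMeasure {n : ℕ} {μ : Measure (LFMeasure n)}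
    (hsq : IsLocallySquareIntegrable μ) :
    IsFiniteMeasureOnCompacts (pairMeasure μ) := by
  refine ⟨fun K hK => ?_⟩
  obtain ⟨R, hR⟩ := hK.isBounded.subset_closedBall 0
  have h0 : (0 : Eucl n × Eucl n) = (0, 0) := rfl
  rw [h0, ← closedBall_prod_same] at hR
  refine (measure_mono hR).trans_lt ?_
  rw [pairMeasure_apply μ (measurableSet_closedBall.prod measurableSet_closedBall)]
  simp only [Measure.prod_prod, ← sq]
  exact hsq _ measurableSet_closedBall isBounded_closedBall

theorem measurable_translate {n : ℕ} (v : Eucl n) : Measurable (translate v) :=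
  ((Measure.measurable_map _ (measurable_const_add v)).comp measurable_subtype_coe).subtype_mk

theorem isAddLeftInvariant_meanMeasure {n : ℕ} {μ : Measure (LFMeasure n)}
    (hinv : IsInvariant μ) : (meanMeasure μ).IsAddLeftInvariant := by
  refine ⟨fun v => ?_⟩
  ext B hB
  rw [Measure.map_apply (measurable_const_add v) hB,
    meanMeasure_apply μ (measurable_const_add v hB), meanMeasure_apply μ hB]
  conv_rhs => rw [← hinv v]
  rw [lintegral_map (measurable_eval hB) (measurable_translate v)]
  refine lintegral_congr fun p => ?_
  rw [translate, Measure.map_apply (measurable_const_add v) hB]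

theorem map_pairMeasure {n : ℕ} {μ : Measure (LFMeasure n)} (hinv : IsInvariant μ) (v : Eucl n) :
    (pairMeasure μ).map (Prod.map (fun x => v + x) (fun x => v + x)) = pairMeasure μ := by
  have hm : Measurable (Prod.map (fun x : Eucl n => v + x) (fun x : Eucl n => v + x)) := by
    fun_prop
  ext S hS
  rw [Measure.map_apply hm hS, pairMeasure_apply μ (hm hS), pairMeasure_apply μ hS]
  conv_rhs => rw [← hinv v]
  have hm' : Measurable fun p : LFMeasure n => p.1.prod p.1 S :=
    (Measure.measurable_coe hS).comp (measurable_prod_self n)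
  rw [lintegral_map hm' (measurable_translate v)]
  refine lintegral_congr fun p => ?_
  rw [← Measure.map_apply hm hS, ← Measure.map_prod_map _ _ (measurable_const_add v)
    (measurable_const_add v)]
  rfl

theorem integral_pairMeasure_translate {n : ℕ} {μ : Measure (LFMeasure n)} (hinv : IsInvariant μ)
    (v : Eucl n) (f : Eucl n × Eucl n → ℝ) :
    ∫ z, f (v + z.1, v + z.2) ∂pairMeasure μ = ∫ z, f z ∂pairMeasure μ := by
  have h : MeasurableEmbedding (Prod.map (fun x : Eucl n => v + x) (fun x : Eucl n => v + x)) :=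
    (((Homeomorph.addLeft v).prodCongr (Homeomorph.addLeft v)).toMeasurableEquiv).measurableEmbedding
  conv_rhs => rw [← map_pairMeasure hinv v]
  rw [h.integral_map]
  rfl

/-- The mean measure is translation invariant and finite on compact sets, so uniqueness of Haar
measure makes it a multiple of Lebesgue measure. Evaluation on the unit ball identifies the factor.
-/
theorem meanMeasure_eq {n : ℕ} {μ : Measure (LFMeasure n)} [IsProbabilityMeasure μ]
    (hinv : IsInvariant μ) (hsq : IsLocallySquareIntegrable μ) :
    0 ≤ intensity μ ∧ meanMeasure μ = ENNReal.ofReal (intensity μ) • volume := by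
  have := isFiniteMeasureOnCompacts_meanMeasure hsq
  have := isAddLeftInvariant_meanMeasure hinv
  have h := Measure.isAddLeftInvariant_eq_smul (meanMeasure μ) volume
  set c := (meanMeasure μ).addHaarScalarFactor volume with hc
  have hpos : 0 < (volume : Measure (Eucl n)).real (ball 0 1) :=
    ENNReal.toReal_pos (measure_ball_pos _ _ one_pos).ne' measure_ball_lt_top.ne
  have hi : intensity μ = c := by
    have h1 : ∫ p : LFMeasure n, p.1.real (ball 0 1) ∂μ = (meanMeasure μ (ball 0 1)).toReal := by
      rw [meanMeasure_apply μ measurableSet_ball]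
      exact integral_toReal (measurable_eval measurableSet_ball).aemeasurable
        (.of_forall fun p => measure_ball_lt_top)
    rw [intensity, h1, h, Measure.smul_apply, div_eq_iff hpos.ne', ENNReal.smul_def, smul_eq_mul,
      ENNReal.toReal_mul]
    rfl
  refine ⟨by rw [hi]; exact c.2, ?_⟩
  rw [hi, ENNReal.ofReal_coe_nnreal]
  exact h

/-- Bounded measurable functions with bounded support are integrable for measures that are finite
on compact sets. -/
theorem integrable_of_bounded_of_support {X F : Type*} [MetricSpace X] [ProperSpace X]
    [MeasurableSpace X] [BorelSpace X] [NormedAddCommGroup F] {m : Measure X}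
    [IsFiniteMeasureOnCompacts m] {f : X → F} (hf : AEStronglyMeasurable f m) {C : ℝ}
    (hC : ∀ x, ‖f x‖ ≤ C) (x₀ : X) {R : ℝ} (hR : ∀ x, f x ≠ 0 → dist x x₀ ≤ R) :
    Integrable f m := by
  have h : f = (closedBall x₀ R).indicator f := by
    ext x
    by_cases hx : x ∈ closedBall x₀ R
    · rw [indicator_of_mem hx]
    · rw [indicator_of_notMem hx]
      by_contra h0
      exact hx (hR x h0)
  rw [h, integrable_indicator_iff measurableSet_closedBall]
  exact Measure.integrableOn_of_bounded (isCompact_closedBall x₀ R).measure_lt_top.ne hf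
    (.of_forall hC)

/-! ### Linear statistics and the autocorrelation functional. -/

/-- Bounded measurable real functions with bounded support. -/
structure IsTest {n : ℕ} (φ : Eucl n → ℝ) : Prop where
  measurable : Measurable φ
  bounded : ∃ C : ℝ, 0 ≤ C ∧ ∀ x, |φ x| ≤ C
  support : ∃ R : ℝ, 0 ≤ R ∧ ∀ x, φ x ≠ 0 → ‖x‖ ≤ R

theorem IsTest.integrable {n : ℕ} {φ : Eucl n → ℝ} (hφ : IsTest φ) (m : Measure (Eucl n))
    [IsFiniteMeasureOnCompacts m] : Integrable φ m := by
  obtain ⟨C, -, hC⟩ := hφ.bounded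
  obtain ⟨R, -, hR⟩ := hφ.support
  exact integrable_of_bounded_of_support hφ.measurable.aestronglyMeasurable hC 0
    (fun x hx => by rw [dist_zero_right]; exact hR x hx)

theorem IsTest.integrable_mul {n : ℕ} {φ ψ : Eucl n → ℝ} (hφ : IsTest φ) (hψ : IsTest ψ)
    (m : Measure (Eucl n × Eucl n)) [IsFiniteMeasureOnCompacts m] :
    Integrable (fun z => φ z.1 * ψ z.2) m := by
  obtain ⟨C, hC0, hC⟩ := hφ.bounded
  obtain ⟨R, -, hR⟩ := hφ.support
  obtain ⟨C', -, hC'⟩ := hψ.bounded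
  obtain ⟨R', -, hR'⟩ := hψ.support
  refine integrable_of_bounded_of_support (C := C * C') (R := max R R')
    ((hφ.measurable.comp measurable_fst).mul (hψ.measurable.comp measurable_snd)).aestronglyMeasurable
    (fun z => ?_) 0 (fun z hz => ?_)
  · rw [norm_mul]
    exact mul_le_mul (hC _) (hC' _) (abs_nonneg _) hC0
  · rw [dist_zero_right, Prod.norm_def]
    exact max_le_max (hR _ (left_ne_zero_of_mul hz)) (hR' _ (right_ne_zero_of_mul hz))

/-- The linear statistic `p ↦ p(φ)`. -/
def linStat {n : ℕ} (φ : Eucl n → ℝ) (p : LFMeasure n) : ℝ := ∫ x, φ x ∂p.1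

theorem measurable_linStat {n : ℕ} {φ : Eucl n → ℝ} (hφ : Measurable φ) :
    Measurable (linStat φ) :=
  (hφ.stronglyMeasurable.integral_kernel (κ := pointKernel n)).measurable

theorem IsTest.integral_linStat {n : ℕ} {μ : Measure (LFMeasure n)} [IsProbabilityMeasure μ]
    (hinv : IsInvariant μ) (hsq : IsLocallySquareIntegrable μ) {φ : Eucl n → ℝ} (hφ : IsTest φ) :
    ∫ p, linStat φ p ∂μ = intensity μ * ∫ x, φ x := by
  have := isFiniteMeasureOnCompacts_meanMeasure hsq
  have h := integral_bind_kernel (hφ.integrable (meanMeasure μ))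
  obtain ⟨h0, h1⟩ := meanMeasure_eq hinv hsq
  rw [← meanMeasure, h1, integral_smul_measure, ENNReal.toReal_ofReal h0] at h
  exact h.symm

theorem linStat_mul {n : ℕ} {φ ψ : Eucl n → ℝ} (p : LFMeasure n) :
    linStat φ p * linStat ψ p = ∫ z, φ z.1 * ψ z.2 ∂(p.1.prod p.1) :=
  (integral_prod_mul φ ψ).symm

theorem IsTest.integral_linStat_mul {n : ℕ} {μ : Measure (LFMeasure n)}
    (hsq : IsLocallySquareIntegrable μ) {φ ψ : Eucl n → ℝ} (hφ : IsTest φ) (hψ : IsTest ψ) :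
    Integrable (fun p => linStat φ p * linStat ψ p) μ ∧
    ∫ p, linStat φ p * linStat ψ p ∂μ = ∫ z, φ z.1 * ψ z.2 ∂pairMeasure μ := by
  have := isFiniteMeasureOnCompacts_pairMeasure hsq
  have h := hφ.integrable_mul hψ (pairMeasure μ)
  simp only [linStat_mul]
  exact ⟨integrable_integral_bind_kernel h, (integral_bind_kernel h).symm⟩

theorem IsTest.memLp_linStat {n : ℕ} {μ : Measure (LFMeasure n)}
    (hsq : IsLocallySquareIntegrable μ) {φ : Eucl n → ℝ} (hφ : IsTest φ) :
    MemLp (linStat φ) 2 μ := by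
  rw [memLp_two_iff_integrable_sq (measurable_linStat hφ.measurable).aestronglyMeasurable]
  simpa only [sq] using (hφ.integral_linStat_mul hsq hφ).1

/-- The autocorrelation `z ↦ ∫ φ(u + z) φ(u) du` of a function. -/
def selfCorr {n : ℕ} (φ : Eucl n → ℝ) (z : Eucl n) : ℝ := ∫ u, φ (u + z) * φ u

/-- Averaging the autocorrelation of a test function against the second moment measure. -/
theorem IsTest.integral_selfCorr_mul {n : ℕ} {μ : Measure (LFMeasure n)}
    (hinv : IsInvariant μ) (hsq : IsLocallySquareIntegrable μ) {b : Eucl n → ℝ}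
    (hb : IsTruncation b) {φ : Eucl n → ℝ} (hφ : IsTest φ) :
    Integrable (fun z : Eucl n × Eucl n => selfCorr φ (z.1 - z.2) * b z.2) (pairMeasure μ) ∧
    ∫ z, selfCorr φ (z.1 - z.2) * b z.2 ∂pairMeasure μ = ∫ z, φ z.1 * φ z.2 ∂pairMeasure μ := by
  have := isFiniteMeasureOnCompacts_pairMeasure hsq
  obtain ⟨C, hC0, hC⟩ := hφ.bounded
  obtain ⟨R, hR0, hR⟩ := hφ.support
  obtain ⟨D, hD⟩ := hb.bounded
  obtain ⟨Rb, hRb⟩ := hb.support_bounded.exists_norm_le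
  have hm := hφ.measurable
  have hbm := hb.measurable
  have hbD : ∀ x, |b x| ≤ D := fun x => by rw [abs_of_nonneg (hb.nonneg x)]; exact hD x
  have e : ∀ z : Eucl n × Eucl n, selfCorr φ (z.1 - z.2) * b z.2
      = ∫ v, φ (v + z.1) * φ (v + z.2) * b z.2 := by
    intro z
    rw [integral_mul_const, selfCorr]
    congr 1
    rw [← integral_add_right_eq_self (fun u => φ (u + (z.1 - z.2)) * φ u) z.2]
    refine integral_congr_ae (.of_forall fun v => ?_)
    have : v + z.2 + (z.1 - z.2) = v + z.1 := by abel
    simp only [this]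
  -- The support is bounded: `b` confines `z.2`, then one factor `φ` confines the shift `v`, and the
  -- other confines `z.1`.
  have i1 : Integrable (fun w : (Eucl n × Eucl n) × Eucl n =>
      φ (w.2 + w.1.1) * φ (w.2 + w.1.2) * b w.1.2) ((pairMeasure μ).prod volume) := by
    refine integrable_of_bounded_of_support (C := C * C * D) (R := 2 * R + |Rb|)
      (Measurable.aestronglyMeasurable (by fun_prop)) (fun w => ?_) 0 (fun w hw => ?_)
    · rw [norm_mul, norm_mul]
      exact mul_le_mul (mul_le_mul (hC _) (hC _) (abs_nonneg _) hC0) (hbD _) (abs_nonneg _)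
        (by positivity)
    · have h1 := hRb _ (right_ne_zero_of_mul hw)
      have h2 := hR _ (right_ne_zero_of_mul (left_ne_zero_of_mul hw))
      have h3 := hR _ (left_ne_zero_of_mul (left_ne_zero_of_mul hw))
      have h4 : ‖w.2‖ ≤ R + |Rb| := by
        calc ‖w.2‖ = ‖(w.2 + w.1.2) - w.1.2‖ := by rw [add_sub_cancel_right]
          _ ≤ _ := (norm_sub_le _ _).trans (add_le_add h2 (h1.trans (le_abs_self _)))
      have h5 : ‖w.1.1‖ ≤ 2 * R + |Rb| := by
        calc ‖w.1.1‖ = ‖(w.2 + w.1.1) - w.2‖ := by rw [add_sub_cancel_left]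
          _ ≤ _ := (norm_sub_le _ _).trans (add_le_add h3 h4)
          _ = _ := by ring
      rw [dist_zero_right, Prod.norm_def, Prod.norm_def]
      refine max_le (max_le h5 ?_) ?_
      · linarith [le_abs_self Rb]
      · linarith
  have i2 : Integrable (fun w : (Eucl n × Eucl n) × Eucl n =>
      φ w.1.1 * φ w.1.2 * b (w.1.2 - w.2)) ((pairMeasure μ).prod volume) := by
    refine integrable_of_bounded_of_support (C := C * C * D) (R := 2 * R + |Rb|)
      (Measurable.aestronglyMeasurable (by fun_prop)) (fun w => ?_) 0 (fun w hw => ?_)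
    · rw [norm_mul, norm_mul]
      exact mul_le_mul (mul_le_mul (hC _) (hC _) (abs_nonneg _) hC0) (hbD _) (abs_nonneg _)
        (by positivity)
    · have h1 := hRb _ (right_ne_zero_of_mul hw)
      have h2 := hR _ (right_ne_zero_of_mul (left_ne_zero_of_mul hw))
      have h3 := hR _ (left_ne_zero_of_mul (left_ne_zero_of_mul hw))
      have h4 : ‖w.2‖ ≤ R + |Rb| := by
        calc ‖w.2‖ = ‖w.1.2 - (w.1.2 - w.2)‖ := by rw [sub_sub_cancel]
          _ ≤ _ := (norm_sub_le _ _).trans (add_le_add h2 (h1.trans (le_abs_self _)))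
      have := abs_nonneg Rb
      rw [dist_zero_right, Prod.norm_def, Prod.norm_def]
      refine max_le (max_le ?_ ?_) ?_ <;> linarith
  -- For each fixed `v`, invariance of the second moment measure moves the shift from the two
  -- factors `φ` onto `b`. The integral over `v` then sees only `b`, whose total mass is one.
  have hswap : ∫ z, (∫ v, φ (v + z.1) * φ (v + z.2) * b z.2) ∂pairMeasure μ
      = ∫ z, (∫ v, φ z.1 * φ z.2 * b (z.2 - v)) ∂pairMeasure μ := by
    rw [integral_integral_swap i1]
    refine Eq.trans ?_ (integral_integral_swap i2).symm
    refine integral_congr_ae (.of_forall fun v => ?_)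
    have h := integral_pairMeasure_translate hinv v
      (fun z => φ z.1 * φ z.2 * b (z.2 - v))
    simp only [add_sub_cancel_left] at h
    exact h
  simp only [e]
  refine ⟨i1.integral_prod_left, ?_⟩
  rw [hswap]
  refine integral_congr_ae (.of_forall fun z => ?_)
  simp only
  rw [integral_const_mul, integral_sub_left_eq_self b volume z.2, hb.integral_eq_one, mul_one]

/-- The autocorrelation functional on autocorrelations of test functions. -/
theorem IsTest.autocorrelation_selfCorr {n : ℕ} {μ : Measure (LFMeasure n)}
    [IsProbabilityMeasure μ] (hinv : IsInvariant μ)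
    (hsq : IsLocallySquareIntegrable μ) {b : Eucl n → ℝ}
    (hb : IsTruncation b) {φ : Eucl n → ℝ} (hφ : IsTest φ)
    (hint : ∫ z, (selfCorr φ z : ℂ) = ((∫ x, φ x) ^ 2 : ℝ)) :
    autocorrelation μ b (fun z => (selfCorr φ z : ℂ))
      = (variance (linStat φ) μ : ℝ) := by
  obtain ⟨i1, h1⟩ := hφ.integral_selfCorr_mul hinv hsq hb
  have h2 : ∀ᵐ p ∂μ, ∫ y, ∫ x, (selfCorr φ (y - x) : ℂ) * (b x : ℂ) ∂p.1 ∂p.1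
      = ((∫ z, selfCorr φ (z.1 - z.2) * b z.2 ∂(p.1.prod p.1) : ℝ) : ℂ) := by
    -- Integrability against the second moment measure passes to `p ⊗ p` for almost every `p`, which
    -- is what Fubini for the iterated integral requires.
    have h3 : ∀ᵐ p ∂μ, Integrable (fun z : Eucl n × Eucl n => selfCorr φ (z.1 - z.2) * b z.2)
        (pairKernel n p) := Measure.ae_integrable_of_integrable_comp i1
    filter_upwards [h3] with p hp
    rw [integral_prod _ hp, ← integral_complex_ofReal]
    refine integral_congr_ae (.of_forall fun y => ?_)
    simp only
    rw [← integral_complex_ofReal]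
    simp only [Complex.ofReal_mul]
  have h4 := integral_bind_kernel i1
  rw [← pairMeasure, h1] at h4
  have h5 := (hφ.integral_linStat_mul hsq hφ).2
  rw [autocorrelation, integral_congr_ae h2, integral_complex_ofReal, hint,
    variance_eq_sub (hφ.memLp_linStat hsq), hφ.integral_linStat hinv hsq]
  change (((∫ p, ∫ z, selfCorr φ (z.1 - z.2) * b z.2 ∂(pairKernel n p) ∂μ) : ℝ) : ℂ) - _ = _
  rw [← h4, ← h5]
  simp only [Pi.pow_apply, sq]
  push_cast
  ring

theorem norm_exp_neg_I_inner (c : ℝ) : ‖Complex.exp (-Complex.I * c)‖ = 1 := by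
  rw [Complex.norm_exp]; simp

/-- The Fourier transform of the autocorrelation of a test function. -/
theorem IsTest.fourierHat_selfCorr {n : ℕ} {φ : Eucl n → ℝ} (hφ : IsTest φ) (ξ : Eucl n) :
    fourierHat (fun z => (selfCorr φ z : ℂ)) ξ = (‖fourierHat (fun x => (φ x : ℂ)) ξ‖ ^ 2 : ℝ) := by
  obtain ⟨C, hC0, hC⟩ := hφ.bounded
  obtain ⟨R, hR0, hR⟩ := hφ.support
  have hm := hφ.measurable
  have i1 : Integrable (fun w : Eucl n × Eucl n => ((φ (w.2 + w.1) * φ w.2 : ℝ) : ℂ) *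
      Complex.exp (-Complex.I * (inner ℝ w.1 ξ : ℝ))) (volume.prod volume) := by
    refine integrable_of_bounded_of_support (C := C * C) (R := 2 * R)
      (Measurable.aestronglyMeasurable (by fun_prop)) (fun w => ?_) 0 (fun w hw => ?_)
    · rw [norm_mul, norm_exp_neg_I_inner, mul_one, Complex.norm_real, norm_mul]
      exact mul_le_mul (hC _) (hC _) (abs_nonneg _) hC0
    · have hw' := left_ne_zero_of_mul hw
      have hw'' : φ (w.2 + w.1) * φ w.2 ≠ 0 := by exact_mod_cast hw'
      have h2 := hR _ (right_ne_zero_of_mul hw'')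
      have h3 := hR _ (left_ne_zero_of_mul hw'')
      have h4 : ‖w.1‖ ≤ R + R := by
        calc ‖w.1‖ = ‖(w.2 + w.1) - w.2‖ := by rw [add_sub_cancel_left]
          _ ≤ _ := (norm_sub_le _ _).trans (add_le_add h3 h2)
      rw [dist_zero_right, Prod.norm_def]
      refine max_le ?_ ?_ <;> linarith
  have h1 : fourierHat (fun z => (selfCorr φ z : ℂ)) ξ
      = ∫ z, ∫ u, ((φ (u + z) * φ u : ℝ) : ℂ) * Complex.exp (-Complex.I * (inner ℝ z ξ : ℝ)) := by
    rw [fourierHat]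
    refine integral_congr_ae (.of_forall fun z => ?_)
    simp only
    rw [integral_mul_const, selfCorr, integral_complex_ofReal]
  rw [h1, integral_integral_swap i1]
  have h2 : ∀ u : Eucl n, ∫ z, ((φ (u + z) * φ u : ℝ) : ℂ) *
      Complex.exp (-Complex.I * (inner ℝ z ξ : ℝ))
      = (φ u : ℂ) * Complex.exp (Complex.I * (inner ℝ u ξ : ℝ)) *
        fourierHat (fun x => (φ x : ℂ)) ξ := by
    intro u
    rw [fourierHat]
    conv_rhs => rw [← integral_add_left_eq_self _ u, ← integral_const_mul]
    refine integral_congr_ae (.of_forall fun z => ?_)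
    simp only [inner_add_left]
    have : Complex.exp (-Complex.I * (inner ℝ z ξ : ℝ)) = Complex.exp (Complex.I * (inner ℝ u ξ : ℝ))
        * Complex.exp (-Complex.I * ((inner ℝ u ξ + inner ℝ z ξ : ℝ) : ℂ)) := by
      rw [← Complex.exp_add]
      congr 1
      push_cast
      ring
    rw [this]
    push_cast
    ring
  simp only [h2]
  rw [integral_mul_const]
  have h3 : ∫ u : Eucl n, (φ u : ℂ) * Complex.exp (Complex.I * (inner ℝ u ξ : ℝ))
      = (starRingEnd ℂ) (fourierHat (fun x => (φ x : ℂ)) ξ) := by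
    rw [fourierHat, ← integral_conj]
    refine integral_congr_ae (.of_forall fun u => ?_)
    simp only [map_mul, Complex.conj_ofReal, ← Complex.exp_conj, map_neg, Complex.conj_I, neg_neg]
  rw [h3, mul_comm, Complex.mul_conj, Complex.normSq_eq_norm_sq]

theorem fourierHat_zero {n : ℕ} (f : Eucl n → ℂ) : fourierHat f 0 = ∫ x, f x := by
  simp [fourierHat]

theorem IsTest.integral_selfCorr {n : ℕ} {φ : Eucl n → ℝ} (hφ : IsTest φ) :
    ∫ z, (selfCorr φ z : ℂ) = ((∫ x, φ x) ^ 2 : ℝ) := by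
  rw [← fourierHat_zero, hφ.fourierHat_selfCorr, fourierHat_zero, integral_complex_ofReal,
    Complex.norm_real, Real.norm_eq_abs, sq_abs]

/-! ### Spectral formula for smooth linear statistics. -/

open scoped ContDiff FourierTransform Convolution ENNReal

theorem isTest_of_continuous {n : ℕ} {φ : Eucl n → ℝ} (hφ : Continuous φ)
    (hs : HasCompactSupport φ) : IsTest φ := by
  obtain ⟨C, hC⟩ := hφ.bounded_above_of_compact_support hs
  obtain ⟨R, hR⟩ := hs.isCompact.isBounded.exists_norm_le
  refine ⟨hφ.measurable, ⟨C, (norm_nonneg _).trans (hC 0), hC⟩, |R|, abs_nonneg _, fun x hx => ?_⟩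
  exact (hR x (subset_tsupport _ hx)).trans (le_abs_self _)

/-- Convolution form provides smoothness and compact support, hence a Schwartz function on which `ν`
can be tested. -/
theorem selfCorr_eq_convolution {n : ℕ} (φ : Eucl n → ℝ) :
    selfCorr φ = (fun x => φ (-x)) ⋆[ContinuousLinearMap.mul ℝ ℝ, volume] φ := by
  ext z
  rw [selfCorr, convolution_def, ← integral_neg_eq_self]
  refine integral_congr_ae (.of_forall fun u => ?_)
  simp only [ContinuousLinearMap.mul_apply']
  rw [mul_comm, neg_add_eq_sub]

theorem hasCompactSupport_comp_neg {n : ℕ} {φ : Eucl n → ℝ} (hs : HasCompactSupport φ) :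
    HasCompactSupport fun x => φ (-x) :=
  hs.comp_homeomorph (Homeomorph.neg (Eucl n))

theorem hasCompactSupport_selfCorr {n : ℕ} {φ : Eucl n → ℝ} (hs : HasCompactSupport φ) :
    HasCompactSupport (selfCorr φ) := by
  rw [selfCorr_eq_convolution]
  exact (hasCompactSupport_comp_neg hs).convolution _ hs

theorem contDiff_selfCorr {n : ℕ} {φ : Eucl n → ℝ} (hφ : ContDiff ℝ ∞ φ)
    (hs : HasCompactSupport φ) : ContDiff ℝ ∞ (selfCorr φ) := by
  rw [selfCorr_eq_convolution]
  have hc := hφ.continuous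
  have h1 : LocallyIntegrable (fun x => φ (-x)) (volume : Measure (Eucl n)) :=
    Continuous.locallyIntegrable (by fun_prop)
  exact hs.contDiff_convolution_right _ h1 hφ

/-- The autocorrelation of a smooth compactly supported function, as a Schwartz function. -/
def selfCorrSchwartz {n : ℕ} {φ : Eucl n → ℝ} (hφ : ContDiff ℝ ∞ φ) (hs : HasCompactSupport φ) :
    𝓢(Eucl n, ℂ) :=
  ((hasCompactSupport_selfCorr hs).comp_left (g := fun t : ℝ => (t : ℂ)) rfl).toSchwartzMap
    (Complex.ofRealCLM.contDiff.comp (contDiff_selfCorr hφ hs))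

theorem fourierHat_eq_fourier {n : ℕ} (f : Eucl n → ℂ) (ξ : Eucl n) :
    fourierHat f ξ = 𝓕 f ((2 * Real.pi)⁻¹ • ξ) := by
  rw [Real.fourier_eq', fourierHat]
  refine integral_congr_ae (.of_forall fun x => ?_)
  simp only [real_inner_smul_right, smul_eq_mul]
  rw [mul_comm]
  congr 2
  have : (Real.pi : ℂ) ≠ 0 := by exact_mod_cast Real.pi_ne_zero
  push_cast
  field_simp

/-- The two Fourier normalisations differ by a dilation of the frequency, which preserves Schwartz
functions. -/
theorem integrable_fourierHat_schwartz {n : ℕ} {ν : Measure (Eucl n)} (hν : ν.HasTemperateGrowth)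
    (f : 𝓢(Eucl n, ℂ)) : Integrable (fourierHat f) ν := by
  have hpi : (2 * Real.pi)⁻¹ ≠ 0 := by positivity
  set g := ContinuousLinearEquiv.smulLeft (M₁ := Eucl n) (R₁ := ℝ) (Units.mk0 _ hpi) with hg
  have h : (fourierHat f : Eucl n → ℂ)
      = SchwartzMap.compCLMOfContinuousLinearEquiv ℂ g (𝓕 f) := by
    ext ξ
    rw [fourierHat_eq_fourier]
    rfl
  rw [h]
  exact SchwartzMap.integrable _

/-- The spectral formula for the variance of smooth linear statistics. -/
theorem variance_linStat_eq {n : ℕ} {μ : Measure (LFMeasure n)}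
    [IsProbabilityMeasure μ] (hinv : IsInvariant μ)
    (hsq : IsLocallySquareIntegrable μ) {b : Eucl n → ℝ}
    (hb : IsTruncation b) {ν : Measure (Eucl n)} (hν : IsDiffractionMeasure μ b ν)
    {φ : Eucl n → ℝ} (hφ : ContDiff ℝ ∞ φ) (hs : HasCompactSupport φ) :
    Integrable (fun ξ => ‖fourierHat (fun x => (φ x : ℂ)) ξ‖ ^ 2) ν ∧
    variance (linStat φ) μ = ∫ ξ, ‖fourierHat (fun x => (φ x : ℂ)) ξ‖ ^ 2 ∂ν := by
  have ht := isTest_of_continuous hφ.continuous hs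
  have h1 := hν.fourier_eq (selfCorrSchwartz hφ hs)
  have h2 := ht.autocorrelation_selfCorr hinv hsq hb ht.integral_selfCorr
  have h3 := integrable_fourierHat_schwartz hν.tempered (selfCorrSchwartz hφ hs)
  have h4 : ∀ ξ, fourierHat (selfCorrSchwartz hφ hs) ξ
      = (‖fourierHat (fun x => (φ x : ℂ)) ξ‖ ^ 2 : ℝ) := ht.fourierHat_selfCorr
  change autocorrelation μ b (fun z => (selfCorr φ z : ℂ)) = _ at h1
  rw [h2] at h1
  have h5 : fourierHat (selfCorrSchwartz hφ hs)
      = fun ξ => ((‖fourierHat (fun x => (φ x : ℂ)) ξ‖ ^ 2 : ℝ) : ℂ) := funext h4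
  rw [h5] at h1 h3
  rw [integral_complex_ofReal] at h1
  exact ⟨h3.re, by exact_mod_cast h1⟩

theorem continuous_fourierHat {n : ℕ} {f : Eucl n → ℂ} (hf : Integrable f) :
    Continuous (fourierHat f) := by
  have : fourierHat f = fun ξ => 𝓕 f ((2 * Real.pi)⁻¹ • ξ) := funext (fourierHat_eq_fourier f)
  rw [this]
  exact (VectorFourier.fourierIntegral_continuous Real.continuous_fourierChar
    (by exact continuous_inner) hf).comp (continuous_const_smul _)

/-- The spectral isometry on smooth test functions. -/
theorem eLpNorm_fourierHat_eq {n : ℕ} {μ : Measure (LFMeasure n)}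
    [IsProbabilityMeasure μ] (hinv : IsInvariant μ)
    (hsq : IsLocallySquareIntegrable μ) {b : Eucl n → ℝ}
    (hb : IsTruncation b) {ν : Measure (Eucl n)} (hν : IsDiffractionMeasure μ b ν)
    {φ : Eucl n → ℝ} (hφ : ContDiff ℝ ∞ φ) (hs : HasCompactSupport φ) :
    eLpNorm (fourierHat (fun x => (φ x : ℂ))) 2 ν
      = eLpNorm (fun p => linStat φ p - intensity μ * ∫ x, φ x) 2 μ := by
  obtain ⟨h1, h2⟩ := variance_linStat_eq hinv hsq hb hν hφ hs
  have ht := isTest_of_continuous hφ.continuous hs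
  have hL := ht.memLp_linStat hsq
  have h3 := hL.sub (memLp_const (intensity μ * ∫ x, φ x))
  have h4 : MemLp (fourierHat (fun x => (φ x : ℂ))) 2 ν :=
    (memLp_two_iff_integrable_sq_norm
      (continuous_fourierHat (ht.integrable volume).ofReal).aestronglyMeasurable).2 h1
  rw [variance_eq_integral hL.aemeasurable, ht.integral_linStat hinv hsq] at h2
  have h5 : ∀ x : ℝ, x ^ 2 = ‖x‖ ^ 2 := fun x => by rw [Real.norm_eq_abs, sq_abs]
  rw [h4.eLpNorm_eq_integral_rpow_norm two_ne_zero ENNReal.ofNat_ne_top]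
  refine Eq.trans ?_ (h3.eLpNorm_eq_integral_rpow_norm two_ne_zero ENNReal.ofNat_ne_top).symm
  simp only [ENNReal.toReal_ofNat, Real.rpow_two, Pi.sub_apply, ← h2, ← h5]

/-! ### From smooth statistics to the number variance. -/

/-- The indicator function of the centered open ball of radius `r`. -/
def ballInd (n : ℕ) (r : ℝ) : Eucl n → ℝ := (ball (0 : Eucl n) r).indicator fun _ => 1

theorem isTest_ballInd (n : ℕ) (r : ℝ) : IsTest (ballInd n r) := by
  refine ⟨measurable_const.indicator measurableSet_ball, ⟨1, zero_le_one, fun x => ?_⟩, |r|,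
    abs_nonneg _, fun x hx => ?_⟩
  · unfold ballInd
    by_cases h : x ∈ ball (0 : Eucl n) r
    · simp [h]
    · rw [indicator_of_notMem h]; simp
  · have h := mem_of_indicator_ne_zero hx
    rw [mem_ball_zero_iff] at h
    exact h.le.trans (le_abs_self r)

theorem integral_ballInd {n : ℕ} (r : ℝ) (m : Measure (Eucl n)) :
    ∫ x, ballInd n r x ∂m = m.real (ball 0 r) := by
  unfold ballInd
  rw [integral_indicator measurableSet_ball]
  simp

theorem fourierHat_ballInd {n : ℕ} (r : ℝ) (ξ : Eucl n) :
    fourierHat (fun x => (ballInd n r x : ℂ)) ξ = ballHat r ξ := by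
  rw [fourierHat, ballHat, ← integral_indicator measurableSet_ball]
  refine integral_congr_ae (.of_forall fun x => ?_)
  unfold ballInd
  by_cases h : x ∈ ball (0 : Eucl n) r
  · simp [h]
  · simp only [indicator_of_notMem h, Complex.ofReal_zero, zero_mul]

/-- The centered linear statistic. -/
def centeredStat {n : ℕ} (μ : Measure (LFMeasure n)) (φ : Eucl n → ℝ) (p : LFMeasure n) : ℝ :=
  linStat φ p - intensity μ * ∫ x, φ x

theorem IsTest.centeredStat_sub {n : ℕ} (μ : Measure (LFMeasure n)) {φ ψ : Eucl n → ℝ}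
    (hφ : IsTest φ) (hψ : IsTest ψ) :
    centeredStat μ (fun x => φ x - ψ x) = centeredStat μ φ - centeredStat μ ψ := by
  ext p
  simp only [centeredStat, linStat, Pi.sub_apply]
  rw [integral_sub (hφ.integrable _) (hψ.integrable _),
    integral_sub (hφ.integrable _) (hψ.integrable _)]
  ring

theorem IsTest.memLp_centeredStat {n : ℕ} {μ : Measure (LFMeasure n)} [IsProbabilityMeasure μ]
    (hsq : IsLocallySquareIntegrable μ) {φ : Eucl n → ℝ} (hφ : IsTest φ) :
    MemLp (centeredStat μ φ) 2 μ :=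
  (hφ.memLp_linStat hsq).sub (memLp_const _)

/-- Smooth bump functions increasing to the indicator function of a ball. -/
theorem exists_smooth_approx_ballInd (n : ℕ) {r : ℝ} (hr : 0 < r) :
    ∃ φ : ℕ → Eucl n → ℝ, (∀ k, ContDiff ℝ ∞ (φ k)) ∧ (∀ k, HasCompactSupport (φ k)) ∧
      (∀ k x, |φ k x| ≤ ballInd n r x) ∧
      ∀ x, Tendsto (fun k => φ k x) atTop (𝓝 (ballInd n r x)) := by
  -- The shift by `2` keeps the inner radius positive at `k = 0`. The outer radius is exactly `r`,
  -- so that the bumps vanish off the open ball and stay below its indicator.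
  have h1 : ∀ k : ℕ, 0 < r * (1 - 1 / ((k : ℝ) + 2)) := fun k => by
    have : 1 / ((k : ℝ) + 2) < 1 := by
      rw [div_lt_one (by positivity)]; have : (0 : ℝ) ≤ k := k.cast_nonneg; linarith
    exact mul_pos hr (by linarith)
  have h2 : ∀ k : ℕ, r * (1 - 1 / ((k : ℝ) + 2)) < r := fun k => by
    have : 0 < 1 / ((k : ℝ) + 2) := by positivity
    nlinarith
  set f : ∀ _ : ℕ, ContDiffBump (0 : Eucl n) := fun k => ⟨_, r, h1 k, h2 k⟩ with hf
  refine ⟨fun k => f k, fun k => (f k).contDiff, fun k => (f k).hasCompactSupport, fun k x => ?_,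
    fun x => ?_⟩
  · rw [abs_of_nonneg (f k).nonneg, ballInd]
    by_cases h : x ∈ ball (0 : Eucl n) r
    · rw [indicator_of_mem h]
      exact (f k).le_one
    · rw [indicator_of_notMem h]
      refine ((f k).zero_of_le_dist ?_).le
      simpa [mem_ball] using h
  · by_cases h : x ∈ ball (0 : Eucl n) r
    · rw [ballInd, indicator_of_mem h]
      refine tendsto_const_nhds.congr' ?_
      have h3 : Tendsto (fun k : ℕ => r * (1 - 1 / ((k : ℝ) + 2))) atTop (𝓝 (r * (1 - 0))) := by
        refine Tendsto.const_mul _ (tendsto_const_nhds.sub ?_)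
        have := tendsto_atTop_add_const_right atTop (2 : ℝ) (tendsto_natCast_atTop_atTop (R := ℝ))
        simp only [one_div]
        exact tendsto_inv_atTop_zero.comp this
      rw [sub_zero, mul_one] at h3
      rw [mem_ball] at h
      filter_upwards [h3.eventually (lt_mem_nhds h)] with k hk
      exact ((f k).one_of_mem_closedBall (mem_closedBall.2 hk.le)).symm
    · rw [ballInd, indicator_of_notMem h]
      refine tendsto_const_nhds.congr fun k => ?_
      refine ((f k).zero_of_le_dist ?_).symm
      simpa [mem_ball] using h

theorem tendsto_integral_approx {n : ℕ} {r : ℝ} {φ : ℕ → Eucl n → ℝ} (hm : ∀ k, IsTest (φ k))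
    (hb : ∀ k x, |φ k x| ≤ ballInd n r x)
    (hl : ∀ x, Tendsto (fun k => φ k x) atTop (𝓝 (ballInd n r x)))
    (m : Measure (Eucl n)) [IsFiniteMeasureOnCompacts m] :
    Tendsto (fun k => ∫ x, φ k x ∂m) atTop (𝓝 (∫ x, ballInd n r x ∂m)) :=
  tendsto_integral_of_dominated_convergence (ballInd n r)
    (fun k => (hm k).measurable.aestronglyMeasurable) ((isTest_ballInd n r).integrable m)
    (fun k => .of_forall (hb k)) (.of_forall hl)

theorem tendsto_fourierHat_approx {n : ℕ} {r : ℝ} {φ : ℕ → Eucl n → ℝ} (hm : ∀ k, IsTest (φ k))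
    (hb : ∀ k x, |φ k x| ≤ ballInd n r x)
    (hl : ∀ x, Tendsto (fun k => φ k x) atTop (𝓝 (ballInd n r x))) (ξ : Eucl n) :
    Tendsto (fun k => fourierHat (fun x => (φ k x : ℂ)) ξ) atTop (𝓝 (ballHat r ξ)) := by
  rw [← fourierHat_ballInd]
  refine tendsto_integral_of_dominated_convergence (ballInd n r) (fun k => ?_)
    ((isTest_ballInd n r).integrable volume) (fun k => .of_forall fun x => ?_)
    (.of_forall fun x => ?_)
  · have := (hm k).measurable
    exact (Measurable.aestronglyMeasurable (by fun_prop))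
  · rw [norm_mul, norm_exp_neg_I_inner, mul_one, Complex.norm_real]
    exact hb k x
  · exact ((Complex.continuous_ofReal.tendsto _).comp (hl x)).mul_const _

theorem abs_integral_le_of_abs_le {n : ℕ} {r : ℝ} {φ : Eucl n → ℝ}
    (hb : ∀ x, |φ x| ≤ ballInd n r x) (m : Measure (Eucl n)) [IsFiniteMeasureOnCompacts m] :
    |∫ x, φ x ∂m| ≤ ∫ x, ballInd n r x ∂m := by
  rw [← Real.norm_eq_abs]
  exact norm_integral_le_of_norm_le ((isTest_ballInd n r).integrable m) (.of_forall hb)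

theorem continuous_ballHat {n : ℕ} (r : ℝ) : Continuous (ballHat r : Eucl n → ℂ) := by
  have h : Continuous (fourierHat fun x => (ballInd n r x : ℂ)) :=
    continuous_fourierHat ((isTest_ballInd n r).integrable volume).ofReal
  rwa [funext (fourierHat_ballInd r)] at h

/-- Dominated convergence is used twice: inside each `p`, giving pointwise convergence of the
statistics, and then over `μ`, where the majorant is square integrable by local
square-integrability. -/
theorem tendsto_eLpNorm_centeredStat {n : ℕ} {μ : Measure (LFMeasure n)} [IsProbabilityMeasure μ]
    (hsq : IsLocallySquareIntegrable μ) {r : ℝ} {φ : ℕ → Eucl n → ℝ} (hm : ∀ k, IsTest (φ k))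
    (hb : ∀ k x, |φ k x| ≤ ballInd n r x)
    (hl : ∀ x, Tendsto (fun k => φ k x) atTop (𝓝 (ballInd n r x))) :
    Tendsto (fun k => eLpNorm (centeredStat μ (φ k) - centeredStat μ (ballInd n r)) 2 μ) atTop
      (𝓝 0) := by
  have ht := isTest_ballInd n r
  have hL := fun k => ((hm k).memLp_centeredStat hsq).sub (ht.memLp_centeredStat hsq)
  have hp : ∀ p : LFMeasure n, Tendsto
      (fun k => (centeredStat μ (φ k) - centeredStat μ (ballInd n r)) p) atTop (𝓝 0) := by
    intro p
    have h1 := tendsto_integral_approx hm hb hl p.1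
    have h2 := (tendsto_integral_approx hm hb hl volume).const_mul (intensity μ)
    have h3 := (h1.sub h2).sub_const (centeredStat μ (ballInd n r) p)
    have h4 : (∫ x, ballInd n r x ∂p.1) - intensity μ * (∫ x, ballInd n r x)
        - centeredStat μ (ballInd n r) p = 0 := sub_self _
    rw [h4] at h3
    exact h3
  set B : LFMeasure n → ℝ := fun p =>
    2 * (linStat (ballInd n r) p + |intensity μ| * ∫ x, ballInd n r x) with hB
  have hbound : ∀ k p, ‖(centeredStat μ (φ k) - centeredStat μ (ballInd n r)) p‖ ≤ B p := by
    intro k p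
    have hc : ∀ ψ : Eucl n → ℝ, (∀ x, |ψ x| ≤ ballInd n r x) →
        |centeredStat μ ψ p| ≤ linStat (ballInd n r) p + |intensity μ| * ∫ x, ballInd n r x := by
      intro ψ hψ
      refine (abs_sub _ _).trans (add_le_add (abs_integral_le_of_abs_le hψ p.1) ?_)
      rw [abs_mul]
      exact mul_le_mul_of_nonneg_left (abs_integral_le_of_abs_le hψ volume) (abs_nonneg _)
    have h1 := hc _ (hb k)
    have h2 := hc (ballInd n r) fun x => (abs_of_nonneg (indicator_nonneg (by simp) x)).le
    rw [Pi.sub_apply, Real.norm_eq_abs]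
    refine (abs_sub _ _).trans ?_
    simp only [hB]
    linarith
  have hB2 : Integrable (fun p => B p ^ 2) μ :=
    ((((ht.memLp_linStat hsq).add (memLp_const _)).const_mul 2).integrable_sq)
  have hint : Tendsto (fun k => ∫ p, ‖(centeredStat μ (φ k) - centeredStat μ (ballInd n r)) p‖ ^ 2
      ∂μ) atTop (𝓝 0) := by
    have h0 : (0 : ℝ) = ∫ _p, (0 : ℝ) ∂μ := by simp
    rw [h0]
    refine tendsto_integral_of_dominated_convergence (fun p => B p ^ 2)
      (fun k => ((hL k).aestronglyMeasurable.norm.pow 2)) hB2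
      (fun k => .of_forall fun p => ?_) (.of_forall fun p => ?_)
    · rw [Real.norm_eq_abs, abs_of_nonneg (by positivity)]
      exact pow_le_pow_left₀ (norm_nonneg _) (hbound k p) 2
    · simpa using (hp p).norm.pow 2
  have heq : ∀ k, eLpNorm (centeredStat μ (φ k) - centeredStat μ (ballInd n r)) 2 μ
      = ENNReal.ofReal ((∫ p, ‖(centeredStat μ (φ k) - centeredStat μ (ballInd n r)) p‖ ^ 2 ∂μ)
        ^ (2 : ℝ)⁻¹) := by
    intro k
    rw [(hL k).eLpNorm_eq_integral_rpow_norm two_ne_zero ENNReal.ofNat_ne_top]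
    simp only [ENNReal.toReal_ofNat, Real.rpow_two]
  simp only [heq]
  have h5 := hint.rpow_const (p := (2 : ℝ)⁻¹) (Or.inr (by norm_num))
  rw [Real.zero_rpow (by norm_num)] at h5
  simpa using ENNReal.tendsto_ofReal h5

/-- The spectral isometry for indicator functions of balls. -/
theorem eLpNorm_ballHat_eq {n : ℕ} {μ : Measure (LFMeasure n)}
    [IsProbabilityMeasure μ] (hinv : IsInvariant μ)
    (hsq : IsLocallySquareIntegrable μ) {b : Eucl n → ℝ}
    (hb : IsTruncation b) {ν : Measure (Eucl n)} (hν : IsDiffractionMeasure μ b ν)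
    {r : ℝ} (hr : 0 < r) :
    eLpNorm (ballHat r) 2 ν = eLpNorm (centeredStat μ (ballInd n r)) 2 μ := by
  obtain ⟨φ, hφ1, hφ2, hφ3, hφ4⟩ := exists_smooth_approx_ballInd n hr
  have ht : ∀ k, IsTest (φ k) := fun k => isTest_of_continuous (hφ1 k).continuous (hφ2 k)
  have hind := isTest_ballInd n r
  set Y := centeredStat μ (ballInd n r) with hY
  set ε : ℕ → ℝ≥0∞ := fun k => eLpNorm (centeredStat μ (φ k) - Y) 2 μ with hε
  have hε0 : Tendsto ε atTop (𝓝 0) := tendsto_eLpNorm_centeredStat hsq ht hφ3 hφ4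
  set g : ℕ → Eucl n → ℂ := fun k => fourierHat (fun x => (φ k x : ℂ)) with hg
  have hgc : ∀ k, Continuous (g k) := fun k =>
    continuous_fourierHat ((ht k).integrable volume).ofReal
  have hGc : Continuous (ballHat r : Eucl n → ℂ) := continuous_ballHat r
  have hiso : ∀ k, eLpNorm (g k) 2 ν = eLpNorm (centeredStat μ (φ k)) 2 μ := fun k =>
    eLpNorm_fourierHat_eq hinv hsq hb hν (hφ1 k) (hφ2 k)
  have hYm : AEStronglyMeasurable Y μ := (hind.memLp_centeredStat hsq).1
  have hXm : ∀ k, AEStronglyMeasurable (centeredStat μ (φ k)) μ := fun k =>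
    ((ht k).memLp_centeredStat hsq).1
  -- The isometry applies to the smooth function `φ k - φ j`, so the transforms are Cauchy in
  -- `L²(ν)`.
  have hdiff : ∀ k j, eLpNorm (g k - g j) 2 ν ≤ ε k + ε j := by
    intro k j
    have h1 := eLpNorm_fourierHat_eq hinv hsq hb hν ((hφ1 k).sub (hφ1 j)) ((hφ2 k).sub (hφ2 j))
    have h2 : fourierHat (fun x => ((φ k x - φ j x : ℝ) : ℂ)) = g k - g j := by
      ext ξ
      have hi : ∀ k, Integrable (fun x : Eucl n => (φ k x : ℂ) *
          Complex.exp (-Complex.I * (inner ℝ x ξ : ℝ))) := fun k => by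
        refine ((ht k).integrable volume).ofReal.mul_bdd (c := 1)
          (Measurable.aestronglyMeasurable (by fun_prop)) (.of_forall fun x => ?_)
        rw [norm_exp_neg_I_inner]
      simp only [hg, Pi.sub_apply, fourierHat]
      rw [← integral_sub (hi k) (hi j)]
      refine integral_congr_ae (.of_forall fun x => ?_)
      simp only
      push_cast
      ring
    change eLpNorm (fourierHat (fun x => ((φ k x - φ j x : ℝ) : ℂ))) 2 ν
      = eLpNorm (centeredStat μ fun x => φ k x - φ j x) 2 μ at h1
    rw [h2, (ht k).centeredStat_sub μ (ht j)] at h1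
    rw [h1]
    have h3 : centeredStat μ (φ k) - centeredStat μ (φ j)
        = (centeredStat μ (φ k) - Y) - (centeredStat μ (φ j) - Y) := by abel
    rw [h3]
    exact eLpNorm_sub_le ((hXm k).sub hYm) ((hXm j).sub hYm) one_le_two
  -- Fatou's lemma in `j`: the transforms converge pointwise everywhere, which identifies the
  -- `L²(ν)` limit as `ballHat r`.
  have hlim : ∀ k, eLpNorm (g k - ballHat r) 2 ν ≤ ε k := by
    intro k
    have h1 := Lp.eLpNorm_lim_le_liminf_eLpNorm (p := 2) (μ := ν) (f := fun j => g k - g j)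
      (fun j => ((hgc k).sub (hgc j)).aestronglyMeasurable) (g k - ballHat r)
      (.of_forall fun ξ => (tendsto_const_nhds (x := g k ξ)).sub
        (tendsto_fourierHat_approx ht hφ3 hφ4 ξ))
    have h2 : Tendsto (fun j => ε k + ε j) atTop (𝓝 (ε k)) := by
      simpa using hε0.const_add (ε k)
    refine h1.trans ?_
    rw [← h2.liminf_eq]
    exact liminf_le_liminf (.of_forall fun j => hdiff k j)
  -- Each of the two inequalities costs one `ε k` on the spectral side and one on the probabilistic
  -- side.
  have h2ε : ∀ x : ℝ≥0∞, Tendsto (fun k => x + ε k + ε k) atTop (𝓝 x) := by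
    intro x
    simpa using (hε0.const_add x).add hε0
  refine le_antisymm (ge_of_tendsto' (h2ε _) fun k => ?_) (ge_of_tendsto' (h2ε _) fun k => ?_)
  · have h1 : (ballHat r : Eucl n → ℂ) = g k - (g k - ballHat r) := by abel
    have h2 : centeredStat μ (φ k) = Y + (centeredStat μ (φ k) - Y) := by abel
    calc eLpNorm (ballHat r) 2 ν ≤ eLpNorm (g k) 2 ν + eLpNorm (g k - ballHat r) 2 ν := by
          conv_lhs => rw [h1]
          exact eLpNorm_sub_le (hgc k).aestronglyMeasurable
            ((hgc k).sub hGc).aestronglyMeasurable one_le_two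
      _ ≤ (eLpNorm Y 2 μ + ε k) + ε k := by
          refine add_le_add ?_ (hlim k)
          rw [hiso]
          conv_lhs => rw [h2]
          exact eLpNorm_add_le hYm ((hXm k).sub hYm) one_le_two
  · have h1 : Y = centeredStat μ (φ k) - (centeredStat μ (φ k) - Y) := by abel
    have h2 : g k = ballHat r + (g k - ballHat r) := by abel
    calc eLpNorm Y 2 μ ≤ eLpNorm (centeredStat μ (φ k)) 2 μ + ε k := by
          conv_lhs => rw [h1]
          exact eLpNorm_sub_le (hXm k) ((hXm k).sub hYm) one_le_two
      _ ≤ (eLpNorm (ballHat r) 2 ν + ε k) + ε k := by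
          refine add_le_add ?_ le_rfl
          rw [← hiso]
          conv_lhs => rw [h2]
          refine (eLpNorm_add_le hGc.aestronglyMeasurable
            ((hgc k).sub hGc).aestronglyMeasurable one_le_two).trans ?_
          gcongr
          exact hlim k

/-- The spectral formula for the number variance. -/
theorem numberVariance_eq {n : ℕ} {μ : Measure (LFMeasure n)}
    [IsProbabilityMeasure μ] (hinv : IsInvariant μ)
    (hsq : IsLocallySquareIntegrable μ) {b : Eucl n → ℝ}
    (hb : IsTruncation b) {ν : Measure (Eucl n)} (hν : IsDiffractionMeasure μ b ν)
    {r : ℝ} (hr : 0 < r) :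
    Integrable (fun ξ : Eucl n => ‖ballHat r ξ‖ ^ 2) ν ∧
    numberVariance μ r = ∫ ξ : Eucl n, ‖ballHat r ξ‖ ^ 2 ∂ν := by
  have h := eLpNorm_ballHat_eq hinv hsq hb hν hr
  have hind := isTest_ballInd n r
  have hY := hind.memLp_centeredStat hsq
  have hGc : Continuous (ballHat r : Eucl n → ℂ) := continuous_ballHat r
  have hG : MemLp (ballHat r) 2 ν := ⟨hGc.aestronglyMeasurable, by rw [h]; exact hY.2⟩
  refine ⟨(memLp_two_iff_integrable_sq_norm hGc.aestronglyMeasurable).1 hG, ?_⟩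
  have hL := hind.memLp_linStat hsq
  have hvar : numberVariance μ r = ∫ p, ‖centeredStat μ (ballInd n r) p‖ ^ 2 ∂μ := by
    have h1 : (fun p : LFMeasure n => p.1.real (ball 0 r)) = linStat (ballInd n r) := by
      ext p
      exact (integral_ballInd r p.1).symm
    rw [numberVariance, h1, variance_eq_integral hL.aemeasurable, hind.integral_linStat hinv hsq]
    simp only [Real.norm_eq_abs, sq_abs, centeredStat]
  rw [hvar]
  rw [hG.eLpNorm_eq_integral_rpow_norm two_ne_zero ENNReal.ofNat_ne_top,
    hY.eLpNorm_eq_integral_rpow_norm two_ne_zero ENNReal.ofNat_ne_top] at h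
  simp only [ENNReal.toReal_ofNat, Real.rpow_two] at h
  have i1 : 0 ≤ ∫ ξ : Eucl n, ‖ballHat r ξ‖ ^ 2 ∂ν := integral_nonneg fun _ => by positivity
  have i2 : 0 ≤ ∫ p, ‖centeredStat μ (ballInd n r) p‖ ^ 2 ∂μ :=
    integral_nonneg fun _ => by positivity
  rw [ENNReal.ofReal_eq_ofReal_iff (Real.rpow_nonneg i1 _) (Real.rpow_nonneg i2 _)] at h
  exact (Real.rpow_left_injOn (by norm_num : (2 : ℝ)⁻¹ ≠ 0) i1 i2 h).symm

/-! ### Averaging over radii for stealthy random measures. -/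

theorem ae_le_norm_of_measure_ball_eq_zero {n : ℕ} {ν : Measure (Eucl n)} {lam : ℝ}
    (h : ν (ball 0 lam) = 0) : ∀ᵐ ξ ∂ν, lam ≤ ‖ξ‖ := by
  rw [ae_iff]
  convert h using 2
  ext ξ
  simp

/-- The integrand of the rescaled number variance. -/
def waveKernel (m : ℕ) (r : ℝ) (ξ : Eucl (m + 1)) : ℝ :=
  waveProfile m (r * ‖ξ‖) * (1 / ‖ξ‖ ^ (m + 2))

theorem measurable_waveKernel (m : ℕ) :
    Measurable fun z : ℝ × Eucl (m + 1) => waveKernel m z.1 z.2 := by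
  have := (continuous_waveProfile m).measurable
  unfold waveKernel
  fun_prop

theorem waveKernel_nonneg (m : ℕ) (r : ℝ) (ξ : Eucl (m + 1)) : 0 ≤ waveKernel m r ξ :=
  mul_nonneg (waveProfile_nonneg m _) (by positivity)

theorem tendsto_mean_waveProfile_mul (m : ℕ) {s : ℝ} (hs : 0 < s) :
    Tendsto (fun R : ℝ => 1 / R * ∫ r in (0 : ℝ)..R, waveProfile m (r * s)) atTop
      (𝓝 (2 ^ (m + 1) * Real.pi ^ m)) := by
  refine ((tendsto_mean_waveProfile m).comp (tendsto_id.atTop_mul_const hs)).congr' ?_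
  filter_upwards [eventually_gt_atTop 0] with R hR
  simp only [Function.comp_apply, id]
  rw [intervalIntegral.integral_comp_mul_right _ hs.ne', zero_mul, smul_eq_mul]
  field_simp

/-- With `M(T)` the mean over `[0, T]`, the integral equals `2 M(2t) - M(t)`. Positivity of the
limit supplies a lower bound at high frequency, although `waveProfile` itself has no positive lower
bound to rely on. -/
theorem tendsto_integral_one_two_waveProfile (m : ℕ) :
    Tendsto (fun t : ℝ => ∫ r in (1 : ℝ)..2, waveProfile m (r * t)) atTop
      (𝓝 (2 ^ (m + 1) * Real.pi ^ m)) := by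
  have h := tendsto_mean_waveProfile m
  have h2 := (h.comp (tendsto_id.atTop_mul_const (two_pos (α := ℝ)))).const_mul 2
  have h3 := h2.sub h
  have e : (2 : ℝ) * (2 ^ (m + 1) * Real.pi ^ m) - 2 ^ (m + 1) * Real.pi ^ m
      = 2 ^ (m + 1) * Real.pi ^ m := by ring
  rw [e] at h3
  refine h3.congr' ?_
  filter_upwards [eventually_gt_atTop 0] with t ht
  have hc := continuous_waveProfile m
  have hsub := intervalIntegral.integral_interval_sub_left (μ := volume)
    (hc.intervalIntegrable 0 (t * 2)) (hc.intervalIntegrable 0 t)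
  rw [intervalIntegral.integral_comp_mul_right _ ht.ne', one_mul, smul_eq_mul, mul_comm 2 t,
    ← hsub]
  simp only [Function.comp_apply, id]
  field_simp

section spectral

variable {m : ℕ} {μ : Measure (LFMeasure (m + 1))} {ν : Measure (Eucl (m + 1))}

/-- Stealthiness discards `ξ = 0`, which the factorisation `norm_ballHat_sq` excludes. -/
theorem numberVariance_div_eq [IsProbabilityMeasure μ] (hinv : IsInvariant μ)
    (hsq : IsLocallySquareIntegrable μ) {b : Eucl (m + 1) → ℝ}
    (hb : IsTruncation b) (hν : IsDiffractionMeasure μ b ν)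
    (hst : IsStealthy ν) {r : ℝ} (hr : 0 < r) :
    Integrable (waveKernel m r) ν ∧ numberVariance μ r / r ^ m = ∫ ξ, waveKernel m r ξ ∂ν := by
  obtain ⟨lam, hlam, h0⟩ := hst
  obtain ⟨h1, h2⟩ := numberVariance_eq hinv hsq hb hν hr
  have hrm : 0 < r ^ m := by positivity
  have hae : (fun ξ : Eucl (m + 1) => ‖ballHat r ξ‖ ^ 2 / r ^ m) =ᵐ[ν] waveKernel m r := by
    filter_upwards [ae_le_norm_of_measure_ball_eq_zero h0] with ξ hξ
    have hξ0 : ξ ≠ 0 := norm_pos_iff.1 (hlam.trans_le hξ)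
    rw [norm_ballHat_sq hr hξ0, mul_div_cancel_left₀ _ hrm.ne', waveKernel]
  exact ⟨(h1.div_const _).congr hae, by rw [h2, ← integral_div, integral_congr_ae hae]⟩

theorem numberVariance_le [IsProbabilityMeasure μ]
    (hsq : IsLocallySquareIntegrable μ) {r R : ℝ} (hrR : r ≤ R) :
    numberVariance μ r ≤ ∫ p, linStat (ballInd (m + 1) R) p ^ 2 ∂μ := by
  have h1 : (fun p : LFMeasure (m + 1) => p.1.real (ball 0 r)) = linStat (ballInd (m + 1) r) := by
    ext p
    exact (integral_ballInd r p.1).symm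
  rw [numberVariance, h1]
  have hL := (isTest_ballInd (m + 1) r).memLp_linStat hsq
  refine (variance_le_expectation_sq hL.aestronglyMeasurable).trans ?_
  refine integral_mono hL.integrable_sq
    ((isTest_ballInd (m + 1) R).memLp_linStat hsq).integrable_sq fun p => ?_
  simp only [Pi.pow_apply, linStat, integral_ballInd]
  exact pow_le_pow_left₀ measureReal_nonneg
    (measureReal_mono (ball_subset_ball hrR) measure_ball_lt_top.ne) 2

/-- The spectral integral is finite. -/
theorem integrable_inv_norm_pow [IsProbabilityMeasure μ] (hinv : IsInvariant μ)
    (hsq : IsLocallySquareIntegrable μ) {b : Eucl (m + 1) → ℝ}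
    (hb : IsTruncation b) (hν : IsDiffractionMeasure μ b ν) (hst : IsStealthy ν) :
    Integrable (fun ξ : Eucl (m + 1) => 1 / ‖ξ‖ ^ (m + 2)) ν := by
  have := hν.locallyFinite
  have hJ := fun {r : ℝ} (hr : 0 < r) => numberVariance_div_eq hinv hsq hb hν hst hr
  obtain ⟨lam, hlam, h0⟩ := hst
  set c : ℝ := 2 ^ (m + 1) * Real.pi ^ m with hc
  have hc0 : 0 < c := by positivity
  -- Beyond `T` the average over `1 < r ≤ 2` exceeds `c / 2`, so `1 / ‖ξ‖ ^ (m + 2)` is at most `2 /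
  -- c` times the averaged kernel. Between `lam` and `T` it is bounded on a set of finite
  -- `ν`-measure.
  obtain ⟨T, hT⟩ := eventually_atTop.1 ((tendsto_integral_one_two_waveProfile m).eventually
    (lt_mem_nhds (half_lt_self hc0)))
  set K := ∫ p, linStat (ballInd (m + 1) 2) p ^ 2 ∂μ with hK
  have hFm := (measurable_waveKernel m).aestronglyMeasurable
    (μ := (volume.restrict (Ioc (1 : ℝ) 2)).prod ν)
  have hF : Integrable (fun z : ℝ × Eucl (m + 1) => waveKernel m z.1 z.2)
      ((volume.restrict (Ioc (1 : ℝ) 2)).prod ν) := by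
    rw [integrable_prod_iff hFm]
    refine ⟨(ae_restrict_iff' measurableSet_Ioc).2
      (.of_forall fun r hr => (hJ (by linarith [hr.1])).1), ?_⟩
    refine Integrable.mono' (integrable_const K) hFm.norm.integral_prod_right' ?_
    refine (ae_restrict_iff' measurableSet_Ioc).2 (.of_forall fun r hr => ?_)
    have hr0 : 0 < r := by linarith [hr.1]
    have e : ∫ ξ, ‖waveKernel m r ξ‖ ∂ν = numberVariance μ r / r ^ m := by
      rw [(hJ hr0).2]
      simp only [Real.norm_eq_abs, abs_of_nonneg (waveKernel_nonneg m r _)]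
    have hnv : 0 ≤ numberVariance μ r := variance_nonneg _ _
    rw [e, Real.norm_eq_abs, abs_of_nonneg (div_nonneg hnv (by positivity))]
    exact (div_le_self hnv (one_le_pow₀ hr.1.le)).trans
      (numberVariance_le hsq hr.2)
  have hG := hF.integral_prod_right
  have hball : Integrable ((ball (0 : Eucl (m + 1)) T).indicator
      fun _ => 1 / lam ^ (m + 2)) ν := by
    rw [integrable_indicator_iff measurableSet_ball]
    exact integrableOn_const measure_ball_lt_top.ne
  refine Integrable.mono' ((hG.const_mul (2 / c)).add hball)
    (Measurable.aestronglyMeasurable (by fun_prop)) ?_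
  filter_upwards [ae_le_norm_of_measure_ball_eq_zero h0] with ξ hξ
  have hξ0 : 0 < ‖ξ‖ := hlam.trans_le hξ
  have hpos : 0 ≤ ∫ r in Ioc (1 : ℝ) 2, waveKernel m r ξ :=
    integral_nonneg fun r => waveKernel_nonneg m r ξ
  rw [Real.norm_eq_abs, abs_of_pos (by positivity)]
  by_cases h : ξ ∈ ball (0 : Eucl (m + 1)) T
  · simp only [Pi.add_apply, indicator_of_mem h]
    have h1 : 1 / ‖ξ‖ ^ (m + 2) ≤ 1 / lam ^ (m + 2) :=
      one_div_le_one_div_of_le (by positivity) (pow_le_pow_left₀ hlam.le hξ _)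
    have h2 : 0 ≤ 2 / c * ∫ r in Ioc (1 : ℝ) 2, waveKernel m r ξ := by positivity
    linarith
  · simp only [Pi.add_apply, indicator_of_notMem h, add_zero]
    rw [mem_ball_zero_iff, not_lt] at h
    have h1 := hT _ h
    have h2 : ∫ r in Ioc (1 : ℝ) 2, waveKernel m r ξ
        = (∫ r in (1 : ℝ)..2, waveProfile m (r * ‖ξ‖)) * (1 / ‖ξ‖ ^ (m + 2)) := by
      simp only [waveKernel]
      rw [intervalIntegral.integral_of_le one_le_two, integral_mul_const]
    rw [h2, ← mul_assoc]
    refine le_mul_of_one_le_left (by positivity) ?_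
    rw [div_mul_eq_mul_div, le_div_iff₀ hc0]
    linarith

/-- Boundedness of `waveProfile` gives the majorant `C / ‖ξ‖^(m+2)`, independent of `r` and
integrable by `integrable_inv_norm_pow`. It justifies both Fubini and the passage to the limit,
where every `ξ ≠ 0` contributes the same mean. -/
theorem tendsto_mean_numberVariance [IsProbabilityMeasure μ] (hinv : IsInvariant μ)
    (hsq : IsLocallySquareIntegrable μ) {b : Eucl (m + 1) → ℝ}
    (hb : IsTruncation b) (hν : IsDiffractionMeasure μ b ν) (hst : IsStealthy ν) :
    (∀ R : ℝ, 0 < R → IntervalIntegrable (fun r : ℝ => numberVariance μ r / r ^ m) volume 0 R) ∧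
    Tendsto (fun R : ℝ => 1 / R * ∫ r in (0 : ℝ)..R, numberVariance μ r / r ^ m) atTop
      (𝓝 (2 ^ (m + 1) * Real.pi ^ m * ∫ ξ : Eucl (m + 1), 1 / ‖ξ‖ ^ (m + 2) ∂ν)) := by
  have := hν.locallyFinite
  have hq := integrable_inv_norm_pow hinv hsq hb hν hst
  have hJ := fun {r : ℝ} (hr : 0 < r) => (numberVariance_div_eq hinv hsq hb hν hst hr).2
  obtain ⟨lam, hlam, h0⟩ := hst
  obtain ⟨C, hC0, hC⟩ := exists_waveProfile_le m
  have hle : ∀ r, 0 < r → ∀ ξ : Eucl (m + 1), ‖waveKernel m r ξ‖ ≤ C * (1 / ‖ξ‖ ^ (m + 2)) := by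
    intro r hr ξ
    rw [Real.norm_eq_abs, abs_of_nonneg (waveKernel_nonneg m r ξ)]
    exact mul_le_mul_of_nonneg_right (hC _ (by positivity)) (by positivity)
  have hF : ∀ R : ℝ, 0 < R → Integrable (fun z : ℝ × Eucl (m + 1) => waveKernel m z.1 z.2)
      ((volume.restrict (Ioc (0 : ℝ) R)).prod ν) := by
    intro R hR
    have hb : Integrable (fun z : ℝ × Eucl (m + 1) => C * (1 / ‖z.2‖ ^ (m + 2)))
        ((volume.restrict (Ioc (0 : ℝ) R)).prod ν) :=
      Integrable.mul_prod (f := fun _ : ℝ => C) (g := fun ξ : Eucl (m + 1) => 1 / ‖ξ‖ ^ (m + 2))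
        (integrableOn_const (by simp)) hq
    refine Integrable.mono' hb (measurable_waveKernel m).aestronglyMeasurable ?_
    rw [← Measure.restrict_univ (μ := ν), Measure.prod_restrict]
    refine (ae_restrict_iff' (measurableSet_Ioc.prod MeasurableSet.univ)).2
      (.of_forall fun z hz => hle _ hz.1.1 _)
  have hJ' : ∀ R : ℝ, 0 < R → ∀ r ∈ Ioc (0 : ℝ) R,
      ∫ ξ, waveKernel m r ξ ∂ν = numberVariance μ r / r ^ m := fun R _ r hr => (hJ hr.1).symm
  refine ⟨fun R hR => ?_, ?_⟩
  · rw [intervalIntegrable_iff_integrableOn_Ioc_of_le hR.le]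
    exact IntegrableOn.congr_fun (hF R hR).integral_prod_left (hJ' R hR) measurableSet_Ioc
  have hswap : ∀ R : ℝ, 0 < R → 1 / R * ∫ r in (0 : ℝ)..R, numberVariance μ r / r ^ m
      = ∫ ξ : Eucl (m + 1), (1 / R * ∫ r in (0 : ℝ)..R, waveProfile m (r * ‖ξ‖)) *
        (1 / ‖ξ‖ ^ (m + 2)) ∂ν := by
    intro R hR
    have h1 : ∫ r in (0 : ℝ)..R, numberVariance μ r / r ^ m
        = ∫ r in (0 : ℝ)..R, ∫ ξ, waveKernel m r ξ ∂ν := by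
      rw [intervalIntegral.integral_of_le hR.le, intervalIntegral.integral_of_le hR.le]
      exact (setIntegral_congr_fun measurableSet_Ioc (hJ' R hR)).symm
    rw [h1, intervalIntegral_integral_swap (by rw [uIoc_of_le hR.le]; exact hF R hR),
      ← integral_const_mul]
    refine integral_congr_ae (.of_forall fun ξ => ?_)
    simp only [waveKernel]
    rw [intervalIntegral.integral_mul_const, mul_assoc]
  have hlim : Tendsto (fun R : ℝ => ∫ ξ : Eucl (m + 1),
      (1 / R * ∫ r in (0 : ℝ)..R, waveProfile m (r * ‖ξ‖)) * (1 / ‖ξ‖ ^ (m + 2)) ∂ν) atTop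
      (𝓝 (∫ ξ : Eucl (m + 1), (2 ^ (m + 1) * Real.pi ^ m) * (1 / ‖ξ‖ ^ (m + 2)) ∂ν)) := by
    refine tendsto_integral_filter_of_dominated_convergence
      (fun ξ : Eucl (m + 1) => C * (1 / ‖ξ‖ ^ (m + 2))) ?_ ?_ (hq.const_mul C) ?_
    · filter_upwards [eventually_gt_atTop 0] with R hR
      have h1 : AEStronglyMeasurable (fun ξ => ∫ r in Ioc (0 : ℝ) R, waveKernel m r ξ) ν :=
        (hF R hR).integral_prod_right.aestronglyMeasurable
      refine (h1.const_mul (1 / R)).congr (.of_forall fun ξ => ?_)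
      simp only [waveKernel]
      rw [intervalIntegral.integral_of_le hR.le, integral_mul_const, mul_assoc]
    · filter_upwards [eventually_gt_atTop 0] with R hR
      refine .of_forall fun ξ => ?_
      rw [norm_mul, Real.norm_eq_abs (1 / ‖ξ‖ ^ (m + 2)),
        abs_of_nonneg (by positivity : 0 ≤ 1 / ‖ξ‖ ^ (m + 2))]
      refine mul_le_mul_of_nonneg_right ?_ (by positivity)
      have h1 := intervalIntegral.norm_integral_le_of_norm_le_const (a := 0) (b := R) (C := C)
        (f := fun r => waveProfile m (r * ‖ξ‖)) (fun r hr => ?_)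
      · rw [sub_zero, abs_of_pos hR] at h1
        rw [norm_mul, Real.norm_eq_abs, abs_of_pos (by positivity : 0 < 1 / R), one_div,
          inv_mul_le_iff₀ hR]
        linarith
      · rw [uIoc_of_le hR.le] at hr
        rw [Real.norm_eq_abs, abs_of_nonneg (waveProfile_nonneg m _)]
        exact hC _ (mul_nonneg hr.1.le (norm_nonneg _))
    · filter_upwards [ae_le_norm_of_measure_ball_eq_zero h0] with ξ hξ
      exact (tendsto_mean_waveProfile_mul m (hlam.trans_le hξ)).mul_const _
  rw [integral_const_mul] at hlim
  refine hlim.congr' ?_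
  filter_upwards [eventually_gt_atTop 0] with R hR
  exact (hswap R hR).symm

end spectral

end Stealthy

end

theorem mainTheorem10 (n : ℕ) (hn : 1 ≤ n)
    (μ : Measure (Stealthy.LFMeasure n)) [IsProbabilityMeasure μ]
    (hinv : Stealthy.IsInvariant μ) (hsq : Stealthy.IsLocallySquareIntegrable μ)
    (b : EuclideanSpace ℝ (Fin n) → ℝ) (hb : Stealthy.IsTruncation b)
    (ν : Measure (EuclideanSpace ℝ (Fin n))) (hν : Stealthy.IsDiffractionMeasure μ b ν)
    (hst : Stealthy.IsStealthy ν) :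
    Integrable (fun ξ : EuclideanSpace ℝ (Fin n) => 1 / ‖ξ‖ ^ (n + 1)) ν ∧
    (∀ R : ℝ, 0 < R → IntervalIntegrable
      (fun r : ℝ => Stealthy.numberVariance μ r / r ^ (n - 1)) volume 0 R) ∧
    Tendsto (fun R : ℝ => 1 / R * ∫ r in (0 : ℝ)..R, Stealthy.numberVariance μ r / r ^ (n - 1))
      atTop
      (𝓝 (2 ^ n * Real.pi ^ (n - 1) *
        ∫ ξ : EuclideanSpace ℝ (Fin n), 1 / ‖ξ‖ ^ (n + 1) ∂ν)) := by
  -- Writing `n = m + 1` turns the truncated subtraction `n - 1` into `m` definitionally.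
  obtain ⟨m, rfl⟩ := Nat.exists_eq_add_of_le' hn
  exact ⟨Stealthy.integrable_inv_norm_pow hinv hsq hb hν hst,
    Stealthy.tendsto_mean_numberVariance hinv hsq hb hν hst⟩
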